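/- Let $x$ be an indeterminate, $R=\mathbb{Z}[x]$, $F$ the field of fractions of $R$, and define $p_0=0$, $p_1=1$, $p_{j+1}=xp_j-p_{j-1}$. For $n\ge 0$ let $A_n$ be the Temperley–Lieb algebra over $F$: the unital associative $F$-algebra with generators $e_1,\dots,e_{n-1}$ and relations $e_i^2=xe_i$, $e_ie_{i\pm1}e_i=e_i$, and $e_ie_j=e_je_i$ for $|i-j|\ge2$. A *partition* of $n$ is a pair $(i,n-2i)$ with $0\le 2i\le n$; write $(i,n-2i)\rhd(j,n-2j)$ if $i>j$. For a partition $\lambda=(f,n-2f)$ of $n$, let $\mathfrak{T}_n(\lambda)$ be the set of sequences $\mathfrak{t}=(\lambda^{(0)},\dots,\lambda^{(n)})$ of partitions $\lambda^{(k)}=(i_k,k-2i_k)$ of $k$ with $i_0=0$, $i_{k}-i_{k-1}\in\{0,1\}$ for $1\le k\le n$, and $\lambda^{(n)}=\lambda$. Put $\mathfrak{t}|_k=(\lambda^{(0)},\dots,\lambda^{(k)})$, $\mathrm{Shape}(\mathfrak{t}|_k)=\lambda^{(k)}$, and write $\mathfrak{t}\rhd\mathfrak{s}$ if $\mathfrak{t}\neq\mathfrak{s}$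 and, for every $k$, the first entry of $\mathrm{Shape}(\mathfrak{t}|_k)$ is at least that of $\mathrm{Shape}(\mathfrak{s}|_k)$. Let $m_\lambda=e_1e_3\cdots e_{2f-1}$, and let $\check A^\lambda$ be the sum of the two-sided ideals of $A_n$ generated by the $m_\mu$ with $\mu\rhd\lambda$. Put $w_{i,j}=e_ie_{i+1}\cdots e_{j-1}$ if $i<j$, $w_{i,j}=e_{i-1}e_{i-2}\cdots e_j$ if $i>j$, $w_{i,i}=1$. For $\mathfrak{t}$ as above let $v_{\mathfrak{t}}=u_nu_{n-1}\cdots u_1$ and $v_{\mathfrak{t}}^*=u_1'u_2'\cdots u_n'$, where $u_k=u_k'=1$ if $i_k=i_{k-1}$, and $u_k=w_{2i_k,k}$, $u_k'=w_{k,2i_k}$ if $i_k=i_{k-1}+1$. Put $m_{\mathfrak{uv}}=v_{\mathfrak u}^*m_\lambda v_{\mathfrak v}$. The cell module $C^\lambda$ is the right $A_n$-submodule of $A_n/\check A^\lambda$ generated by $m_\lambda+\check A^\lambda$; put $m_{\mathfrak{t}}=m_\lambda v_{\mathfrak{t}}+\check A^\lambda\in C^\lambda$. Let $\langle\cdot,\cdot\rangle$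 be the bilinear form on $C^\lambda$ determined by $$m_{\mathfrak{us}}m_{\mathfrak{tv}}\equiv\langle m_{\mathfrak{s}},m_{\mathfrak{t}}\rangle\, m_{\mathfrak{uv}}\pmod{\check A^\lambda}\qquad(\mathfrak{u},\mathfrak{s},\mathfrak{t},\mathfrak{v}\in\mathfrak{T}_n(\lambda)).$$ Define $T_0=T_1=0$, $T_2=e_1$, $z_j=\sum_{l=0}^jx^lT_{j-l}$, and, for $2\le j<n$, $$T_{j+1}=-e_jT_j-T_je_j+e_je_{j-1}T_je_j-z_{j-1}-e_jz_{j-2}.$$ For $\mathfrak{t}$ as above let $r_{\mathfrak{t}}(0)=r_{\mathfrak{t}}(1)=0$ and, for $k\ge2$ and $i=i_k$, let $r_{\mathfrak{t}}(k)=(p_i-xp_{i-1})p_{k-i+1}$ if $i_{k-1}=i-1$ and $r_{\mathfrak{t}}(k)=(p_{k-i+1}-xp_{k-i})p_i$ if $i_{k-1}=i$. Let $\mathfrak{R}(k)$ be the set of all $r_{\mathfrak{u}}(k)$ with $\mathfrak{u}\in\mathfrak{T}_k(\mu)$, $\mu$ a partition of $k$, and let $$F_{\mathfrak{t}}=\prod_{k=2}^n\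 \prod_{r\in\mathfrak{R}(k),\,r\ne r_{\mathfrak{t}}(k)}\frac{T_k-r}{r_{\mathfrak{t}}(k)-r},\qquad f_{\mathfrak{t}}=m_{\mathfrak{t}}F_{\mathfrak{t}}\in C^\lambda,$$ the factors for different $k$ being multiplied in order of increasing $k$. **Statement.** Let $\lambda$ be a partition of $n$. There is exactly one form $\langle\cdot,\cdot\rangle$ as above, and $\{f_{\mathfrak{t}}:\mathfrak{t}\in\mathfrak{T}_n(\lambda)\}$ is a basis of $C^\lambda$, so that scalars $e_k(\mathfrak{s},\mathfrak{t})\in F$ are defined by $f_{\mathfrak{t}}e_k=\sum_{\mathfrak{s}\in\mathfrak{T}_n(\lambda)}e_k(\mathfrak{s},\mathfrak{t})f_{\mathfrak{s}}$. If $1\le k<n$, and $\mathfrak{s},\mathfrak{t}\in\mathfrak{T}_n(\lambda)$ satisfy $\mathfrak{t}\rhd\mathfrak{s}$ and $e_k(\mathfrak{s},\mathfrak{t})\ne0$, and $\mathrm{Shape}(\mathfrak{t}|_k)=(i,k-2i)$, then $$\langle f_{\mathfrak{s}},f_{\mathfrak{s}}\rangle=\frac{p_{k-2i+1}(xp_{k-2i+2}-p_{k-2i+1})}{(p_{k-2i+2})^2}\langle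 f_{\mathfrak{t}},f_{\mathfrak{t}}\rangle=\frac{p_{k-2i+1}p_{k-2i+3}}{(p_{k-2i+2})^2}\langle f_{\mathfrak{t}},f_{\mathfrak{t}}\rangle.$$ -/

import Mathlib

noncomputable section

namespace TemperleyLieb

/-! ### Partitions and tableaux -/

/-- A partition `(i, n - 2i)` of `n`, `0 ≤ 2i ≤ n`, recorded by its first entry `i`. -/
abbrev Ptn (n : ℕ) : Type := {i : Fin (n + 1) // 2 * (i : ℕ) ≤ n}

/-- The first entry `i` of the partition `(i, n - 2i)`. -/
def Ptn.fst {n : ℕ} (lam : Ptn n) : ℕ := (lam.1 : ℕ)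

/-- The order `μ ▷ λ` on partitions of `n`. -/
def Ptn.Dominates {n : ℕ} (mu lam : Ptn n) : Prop := lam.fst < mu.fst

/-- `𝔗_n(λ)`: sequences `(λ⁽⁰⁾, …, λ⁽ⁿ⁾)` of partitions `λ⁽ᵏ⁾` of `k` with `λ⁽⁰⁾ = (0,0)`,
`λ⁽ⁿ⁾ = λ` and `λ⁽ᵏ⁾ → λ⁽ᵏ⁺¹⁾`. For `λ⁽ᵏ⁺¹⁾ = (i, k + 1 - 2i)`, the arrow says that `λ⁽ᵏ⁾` is
`(i, k - 2i)` or `(i - 1, k - 2i + 2)`. -/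
abbrev Tableau (n : ℕ) (lam : Ptn n) : Type :=
  {t : (k : Fin (n + 1)) → Ptn (k : ℕ) //
    (t 0).fst = 0 ∧
    (∀ k : Fin n, (t k.castSucc).fst = (t k.succ).fst ∨ (t k.castSucc).fst + 1 = (t k.succ).fst) ∧
    t (Fin.last n) = lam}

section Tableaux

variable {n : ℕ} {lam : Ptn n}

/-- If `k ≤ n` and `t|_k` has shape `(i, k - 2i)`, then `t.row k = i`. -/
def Tableau.row (t : Tableau n lam) (k : ℕ) : ℕ :=
  if h : k < n + 1 then (t.1 ⟨k, h⟩).fst else 0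

/-- The order `t ▷ s` on tableaux. -/
def Tableau.Dominates (t s : Tableau n lam) : Prop :=
  (∀ k, 1 ≤ k → k ≤ n → s.row k ≤ t.row k) ∧ t ≠ s

end Tableaux

/-! ### The algebra -/

section Algebra

variable {K : Type*} [Field K] (x : K) (n : ℕ)

/-- Index set of the generators `e_1, …, e_{n-1}`. -/
abbrev Gen : Type := {i : ℕ // 1 ≤ i ∧ i < n}

open FreeAlgebra in
/-- The defining relations with parameter `x`. -/
inductive Rel : FreeAlgebra K (Gen n) → FreeAlgebra K (Gen n) → Prop
  | sq (i : Gen n) : Rel (ι K i * ι K i) (x • ι K i)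
  | neighbour (i j : Gen n) (h : i.1 + 1 = j.1 ∨ j.1 + 1 = i.1) :
      Rel (ι K i * ι K j * ι K i) (ι K i)
  | far (i j : Gen n) (h : i.1 + 2 ≤ j.1 ∨ j.1 + 2 ≤ i.1) :
      Rel (ι K i * ι K j) (ι K j * ι K i)

/-- The Temperley–Lieb algebra over `K` with parameter `x` and generators `e_1, …, e_{n-1}`. -/
abbrev TL : Type _ := RingQuot (Rel x n)

/-- The generator `e_i`, `1 ≤ i < n` (only such indices are ever relevant). -/
def e (i : ℕ) : TL x n :=
  if h : 1 ≤ i ∧ i < n then RingQuot.mkAlgHom K (Rel x n) (FreeAlgebra.ι K ⟨i, h⟩) else 0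

/-- `w_{i,j}`: equal to `e_i e_{i+1} ⋯ e_{j-1}` if `i < j`, to `e_{i-1} e_{i-2} ⋯ e_j` if `j < i`,
and to `1` if `i = j`. -/
def w (i j : ℕ) : TL x n :=
  if i < j then ((List.range' i (j - i)).map (e x n)).prod
  else ((List.range' j (i - j)).reverse.map (e x n)).prod

variable {n} {lam : Ptn n}

/-- `m_λ = e_1 e_3 ⋯ e_{2f-1}` for `λ = (f, n - 2f)`. -/
def mPtn (lam : Ptn n) : TL x n :=
  ((List.range lam.fst).map fun j => e x n (2 * j + 1)).prod

/-- The element `v_{t|_k}`, viewed in the algebra on `n` strands. -/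
def vUpTo (t : Tableau n lam) : ℕ → TL x n
  | 0 => 1
  | k + 1 =>
    if t.row k = t.row (k + 1) then vUpTo t k else w x n (2 * t.row (k + 1)) (k + 1) * vUpTo t k

/-- `v_t`. -/
def v (t : Tableau n lam) : TL x n := vUpTo x t n

/-- The element `v_{t|_k}^*`, viewed in the algebra on `n` strands. -/
def vStarUpTo (t : Tableau n lam) : ℕ → TL x n
  | 0 => 1
  | k + 1 =>
    if t.row k = t.row (k + 1) then vStarUpTo t k
    else vStarUpTo t k * w x n (k + 1) (2 * t.row (k + 1))

/-- `v_t^*`. -/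
def vStar (t : Tableau n lam) : TL x n := vStarUpTo x t n

/-- `m_{uv} = v_u^* m_λ v_v`. -/
def mPair (u t : Tableau n lam) : TL x n := vStar x u * mPtn x lam * v x t

/-- The sum of the two-sided ideals generated by the `m_μ` with `μ ▷ λ`. -/
def upperIdeal (lam : Ptn n) : TwoSidedIdeal (TL x n) :=
  ⨆ (mu : Ptn n) (_ : mu.Dominates lam), TwoSidedIdeal.span {mPtn x mu}

/-- The quotient of the algebra by `upperIdeal`. -/
abbrev UpperQuot (lam : Ptn n) : Type _ := (upperIdeal x lam).ringCon.Quotient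

/-- The quotient map. -/
abbrev toQuot (lam : Ptn n) : TL x n →ₐ[K] UpperQuot x lam := (upperIdeal x lam).ringCon.mkₐ K

/-- The cell module `C^λ`: the right submodule of the quotient generated by the class of `m_λ`,
that is, the set of all classes of `m_λ a`. -/
def cellModule (lam : Ptn n) : Submodule K (UpperQuot x lam) :=
  LinearMap.range ((toQuot x lam).toLinearMap ∘ₗ LinearMap.mulLeft K (mPtn x lam))

/-- The class of `m_λ a` in `C^λ`. -/
def cellMk (lam : Ptn n) (a : TL x n) : cellModule x lam :=
  ⟨toQuot x lam (mPtn x lam * a), a, rfl⟩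

/-- The right action of the algebra on `C^λ`. -/
def act (c : cellModule x lam) (a : TL x n) : cellModule x lam :=
  ⟨c.1 * toQuot x lam a, by
    obtain ⟨_, b, rfl⟩ := c
    exact ⟨b * a, by simp [mul_assoc]⟩⟩

/-- `m_t`, the class of `m_λ v_t` in `C^λ`. -/
def mTab (t : Tableau n lam) : cellModule x lam := cellMk x lam (v x t)

/-- The defining property of the bilinear form that the cellular basis `m_{uv}` puts on `C^λ`:
`m_{us} m_{tv} ≡ ⟨m_s, m_t⟩ m_{uv}` modulo `upperIdeal`. -/
def IsCellForm (lam : Ptn n) (B : LinearMap.BilinForm K (cellModule x lam)) : Prop :=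
  ∀ u s t v : Tableau n lam,
    mPair x u s * mPair x t v - B (mTab x s) (mTab x t) • mPair x u v ∈ upperIdeal x lam

/-- The bilinear form `⟨·,·⟩` on `C^λ`: the form with the property `IsCellForm`. -/
def cellForm (lam : Ptn n) : LinearMap.BilinForm K (cellModule x lam) :=
  Classical.epsilon (IsCellForm x lam)

/-! ### Jucys–Murphy elements and the seminormal basis -/

/-- `p_0 = 0`, `p_1 = 1`, `p_{i+1} = x p_i - p_{i-1}`. -/
def p : ℕ → K
  | 0 => 0
  | 1 => 1
  | i + 2 => x * p (i + 1) - p i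

variable (n)

/-- The Jucys–Murphy elements: `T_0 = T_1 = 0`, `T_2 = e_1` and, for `j = i + 2 ≥ 2`,
`T_{j+1} = -e_j T_j - T_j e_j + e_j e_{j-1} T_j e_j - z_{j-1} - e_j z_{j-2}`, where
`z_m = ∑_{k=0}^m x^k T_{m-k}` has been written out. -/
def JM : ℕ → TL x n
  | 0 => 0
  | 1 => 0
  | 2 => e x n 1
  | i + 3 =>
    - (e x n (i + 2) * JM (i + 2)) - JM (i + 2) * e x n (i + 2)
      + e x n (i + 2) * e x n (i + 1) * JM (i + 2) * e x n (i + 2)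
      - ∑ k ∈ Finset.range (i + 2), x ^ k • JM (i + 1 - k)
      - e x n (i + 2) * ∑ k ∈ Finset.range (i + 1), x ^ k • JM (i - k)
termination_by i => i

variable {n}

/-- The scalars `r_t(k)`, `0 ≤ k ≤ n`. -/
def r (t : Tableau n lam) (k : ℕ) : K :=
  if k ≤ 1 then 0
  else if t.row (k - 1) + 1 = t.row k then
    (p x (t.row k) - x * p x (t.row k - 1)) * p x (k - t.row k + 1)
  else
    (p x (k - t.row k + 1) - x * p x (k - t.row k)) * p x (t.row k)

open Classical in
/-- `ℜ(k)`: the set of all `r_t(k)` with `t` a tableau whose shape is a partition of `k`. -/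
def contents (k : ℕ) : Finset K :=
  (Finset.univ : Finset (Σ mu : Ptn k, Tableau k mu)).image fun t => r x t.2 k

open Classical Polynomial in
/-- `F_t = ∏_{k=2}^n ∏_{r ∈ ℜ(k), r ≠ r_t(k)} (T_k - r) / (r_t(k) - r)`, the factors being ordered
by increasing `k`; for fixed `k` the factor is a polynomial evaluated at `T_k`. -/
def proj (t : Tableau n lam) : TL x n :=
  ((List.range' 2 (n - 1)).map fun k =>
    aeval (JM x n k)
      (∏ c ∈ (contents x k).erase (r x t k), C (r x t k - c)⁻¹ * (X - C c))).prod

/-- `f_t = m_t F_t`. -/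
def f (t : Tableau n lam) : cellModule x lam := act x (mTab x t) (proj x t)

/-- The coefficients `e_k(s,t)`, defined by `f_t e_k = ∑_s e_k(s,t) f_s`. -/
def eCoeff (k : ℕ) (s t : Tableau n lam) : K :=
  Classical.epsilon
    (fun c : Tableau n lam → K => act x (f x t) (e x n k) = ∑ u, c u • f x u) s

end Algebra

end TemperleyLieb

end

noncomputable section

namespace TemperleyLieb

/-! ### The polynomials `p_j` -/

section Polynomials

variable {K : Type*} [Field K] (x : K)

/-! The proof realises the cell module in seminormal form. Attach to a tableau its row sequence `i`
and the height `k - 2 * i k`: the height rises when the row is constant and falls when the row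
grows. On functions on such paths, `e_{j+1}` (`pathGen x n f j`) mixes only paths that agree off `j
+ 1` and whose entries at `j` and `j + 2` differ by one. Such a block consists of a peak and, if the
height at `j` is positive, a valley. On it `e_{j+1}` is the rank-one matrix with column `(1,
valleyWeight)` and row `(peakWeight, 1)`. The relations follow from the facts that the two weights
add up to `x` and that consecutive weights are reciprocal.

In this representation the Jucys–Murphy elements are diagonal on paths (`pathAct_JM`), with
eigenvalues `r_t(k)` that separate paths, so `F_t` projects onto the coordinate `t`
(`pathAct_proj`). Acting on the indicator of the most dominant path gives a map from `C^λ` to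
functions on paths (`cellToPath`). The image of `m_t` has coefficient `1` at `t` and is supported on
paths lying weakly above it (`isLeading_cellToPath_mTab`), so on paths `f_t` becomes exactly the
indicator of `t` (`cellToPath_f`). Hence the `f_t` are independent; since the `m_t` span
(`span_mTab`), the `f_t` are a basis by counting.

The generators are self-adjoint for a diagonal form with explicit squared norms `pathNorm`
(`pathForm_pathGen`). Because `m_λ a m_λ` is a scalar multiple of `m_λ` modulo higher ideals
(`exists_smul_oddProd_sub_mem`), the pullback of this form is the cell form
(`isCellForm_inducedForm`), and it is the only one (`IsCellForm.unique`). If `e_k(s,t) ≠ 0` and `t ▷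
s`, then `s` and `t` are the peak and the valley of one block, and the claim is the ratio of their
norms (`pathNorm_peak`). -/

theorem p_succ_succ (j : ℕ) : p x (j + 2) = x * p x (j + 1) - p x j := rfl

theorem p_zero : p x 0 = 0 := rfl

theorem p_one : p x 1 = 1 := rfl

theorem p_two : p x 2 = x := by simp [p]

/-- The left side is the Casoratian of two shifts of one solution of the recursion, hence
independent of `i`; at `i = 0` it is `p_h`. Every comparison of Jucys–Murphy eigenvalues below
reduces to it. -/
theorem p_mul_sub_p_mul (h i : ℕ) :
    p x (i + 1) * p x (h + i) - p x i * p x (h + i + 1) = p x h := by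
  induction i with
  | zero => simp [p]
  | succ i ih =>
    have h₁ := p_succ_succ x i
    have h₂ := p_succ_succ x (h + i)
    simp only [← add_assoc] at *
    rw [h₁, h₂]
    linear_combination ih

/-- Specialising the indeterminate to `2` turns the recursion into that of the natural numbers. This
shows that `p_j` is a nonzero polynomial for `j > 0`. -/
theorem exists_polynomial_eq_p {F : Type*} [Field F] [Algebra (Polynomial ℤ) F] (j : ℕ) :
    ∃ q : Polynomial ℤ,
      algebraMap (Polynomial ℤ) F q = p (algebraMap (Polynomial ℤ) F Polynomial.X) j ∧
        q.eval 2 = j := by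
  induction j using Nat.twoStepInduction with
  | zero => exact ⟨0, by simp [p], by simp⟩
  | one => exact ⟨1, by simp [p], by simp⟩
  | more j h₀ h₁ =>
    obtain ⟨q₀, hq₀, he₀⟩ := h₀
    obtain ⟨q₁, hq₁, he₁⟩ := h₁
    refine ⟨Polynomial.X * q₁ - q₀, ?_, ?_⟩
    · rw [p_succ_succ, map_sub, map_mul, hq₀, hq₁]
    · simp only [Polynomial.eval_sub, Polynomial.eval_mul, Polynomial.eval_X, he₀, he₁]
      push_cast
      ring

theorem p_succ_ne_zero {F : Type*} [Field F] [Algebra (Polynomial ℤ) F]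
    [IsFractionRing (Polynomial ℤ) F] (j : ℕ) :
    p (algebraMap (Polynomial ℤ) F Polynomial.X) (j + 1) ≠ 0 := by
  obtain ⟨q, hq, he⟩ := exists_polynomial_eq_p (F := F) (j + 1)
  rw [← hq]
  intro h0
  have hq0 : q = 0 :=
    (map_eq_zero_iff _ (IsFractionRing.injective (Polynomial ℤ) F)).mp h0
  rw [hq0, Polynomial.eval_zero] at he
  exact Nat.cast_ne_zero.mpr (Nat.succ_ne_zero j) he.symm

end Polynomials

/-! ### Tableaux as row sequences -/

/-- The row sequences of the tableaux of shape `(f, n - 2f)`, continued by `0` beyond `n`. -/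
def IsPath (n f : ℕ) (i : ℕ → ℕ) : Prop :=
  i 0 = 0 ∧ (∀ k < n, i (k + 1) = i k ∨ i (k + 1) = i k + 1) ∧ (∀ k, 2 * i k ≤ k) ∧ i n = f ∧
    ∀ k, n < k → i k = 0

namespace IsPath

variable {n f : ℕ} {i : ℕ → ℕ}

theorem zero (h : IsPath n f i) : i 0 = 0 := h.1

theorem step (h : IsPath n f i) {k : ℕ} (hk : k < n) : i (k + 1) = i k ∨ i (k + 1) = i k + 1 :=
  h.2.1 k hk

theorem two_mul_le (h : IsPath n f i) (k : ℕ) : 2 * i k ≤ k := h.2.2.1 k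

theorem last (h : IsPath n f i) : i n = f := h.2.2.2.1

theorem eq_zero (h : IsPath n f i) {k : ℕ} (hk : n < k) : i k = 0 := h.2.2.2.2 k hk

theorem mono (h : IsPath n f i) {k l : ℕ} (hkl : k ≤ l) (hl : l ≤ n) : i k ≤ i l := by
  induction l, hkl using Nat.le_induction with
  | base => exact le_rfl
  | succ l _ ih =>
    have := ih (by omega)
    rcases h.step (k := l) (by omega) with h | h <;> omega

/-- Changing a single entry of a path. -/
theorem update (h : IsPath n f i) {j c : ℕ} (hj : j + 1 < n) (hc : i (j + 2) = i j + 1)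
    (hcc : c = i j ∨ c = i j + 1 ∧ 2 * i j < j) :
    IsPath n f (Function.update i (j + 1) c) := by
  refine ⟨?_, ?_, ?_, ?_, ?_⟩
  · rw [Function.update_of_ne (by omega), h.zero]
  · intro k hk
    have hstep := h.step hk
    by_cases h₁ : k = j
    · subst h₁
      simp
      omega
    · by_cases h₂ : k = j + 1
      · subst h₂
        rw [Function.update_self, Function.update_of_ne (by omega)]
        change i (j + 2) = c ∨ i (j + 2) = c + 1
        omega
      · rwa [Function.update_of_ne (by omega), Function.update_of_ne h₂]
  · intro k
    have := h.two_mul_le k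
    have h' := h.two_mul_le j
    by_cases h₂ : k = j + 1
    · subst h₂
      simp
      omega
    · rwa [Function.update_of_ne h₂]
  · rw [Function.update_of_ne (by omega), h.last]
  · intro k hk
    rw [Function.update_of_ne (by omega), h.eq_zero hk]

end IsPath

section Rows

variable {n : ℕ} {lam : Ptn n}

theorem Tableau.row_eq (t : Tableau n lam) {k : ℕ} (hk : k < n + 1) :
    t.row k = (t.1 ⟨k, hk⟩).fst := dif_pos hk

theorem Tableau.isPath (t : Tableau n lam) : IsPath n lam.fst t.row := by
  refine ⟨?_, ?_, ?_, ?_, ?_⟩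
  · rw [t.row_eq (Nat.succ_pos n)]
    exact t.2.1
  · intro k hk
    rw [t.row_eq (show k < n + 1 by omega), t.row_eq (show k + 1 < n + 1 by omega)]
    rcases t.2.2.1 ⟨k, hk⟩ with h | h
    · exact Or.inl h.symm
    · exact Or.inr h.symm
  · intro k
    by_cases hk : k < n + 1
    · rw [t.row_eq hk]
      exact (t.1 ⟨k, hk⟩).2
    · simp [Tableau.row, hk]
  · rw [t.row_eq (Nat.lt_succ_self n)]
    exact congrArg Ptn.fst t.2.2.2
  · intro k hk
    have : ¬ k < n + 1 := by omega
    simp [Tableau.row, this]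

theorem Tableau.row_injective : Function.Injective (Tableau.row : Tableau n lam → ℕ → ℕ) := by
  intro s t h
  apply Subtype.ext
  funext k
  apply Subtype.ext
  apply Fin.ext
  have := congrFun h (k : ℕ)
  rwa [s.row_eq k.2, t.row_eq k.2] at this

theorem Tableau.exists_row_eq {i : ℕ → ℕ} (h : IsPath n lam.fst i) :
    ∃ t : Tableau n lam, t.row = i := by
  refine ⟨⟨fun k => ⟨⟨i k, by have := h.two_mul_le k; omega⟩, h.two_mul_le k⟩, h.zero, ?_, ?_⟩, ?_⟩
  · intro k
    rcases h.step k.2 with h | h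
    · exact Or.inl h.symm
    · exact Or.inr h.symm
  · apply Subtype.ext
    apply Fin.ext
    exact h.last
  · funext k
    by_cases hk : k < n + 1
    · rw [Tableau.row_eq _ hk]
      rfl
    · rw [Tableau.row, dif_neg hk, h.eq_zero (by omega)]

end Rows

/-! ### The path representation -/

section PathRep

variable {K : Type*} [Field K] (x : K) (n f j : ℕ)

/-- The ratio `p_{h+2} / p_{h+1}`, where `h = j - 2 i_j`. -/
def peakWeight (i : ℕ → ℕ) : K := p x (j - 2 * i j + 2) / p x (j - 2 * i j + 1)

/-- The ratio `p_h / p_{h+1}`, where `h = j - 2 i_j`. -/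
def valleyWeight (i : ℕ → ℕ) : K := p x (j - 2 * i j) / p x (j - 2 * i j + 1)

/-- The pairing of a function on paths with the covector that defines `e_{j+1}` on the block
of paths which agree with `i` except at `j + 1`. -/
def blockSum (i : ℕ → ℕ) (ψ : (ℕ → ℕ) → K) : K :=
  peakWeight x j i * ψ (Function.update i (j + 1) (i j)) +
    if 2 * i j < j then ψ (Function.update i (j + 1) (i j + 1)) else 0

open Classical in
/-- The right action of `e_{j+1}` on functions on paths. -/
def pathGen : ((ℕ → ℕ) → K) →ₗ[K] ((ℕ → ℕ) → K) where
  toFun ψ i :=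
    if IsPath n f i ∧ i (j + 2) = i j + 1 then
      (if i (j + 1) = i j then 1 else valleyWeight x j i) * blockSum x j i ψ
    else 0
  map_add' ψ χ := by
    funext i
    simp only [Pi.add_apply, blockSum]
    split_ifs <;> ring
  map_smul' c ψ := by
    funext i
    simp only [Pi.smul_apply, smul_eq_mul, RingHom.id_apply, blockSum]
    split_ifs <;> ring

variable {x n f j} {i : ℕ → ℕ} {ψ : (ℕ → ℕ) → K}

theorem pathGen_peak (hi : IsPath n f i) (hc : i (j + 2) = i j + 1) (h : i (j + 1) = i j) :
    pathGen x n f j ψ i = blockSum x j i ψ := by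
  simp [pathGen, hi, hc, h]

theorem pathGen_valley (hi : IsPath n f i) (hc : i (j + 2) = i j + 1) (h : i (j + 1) = i j + 1) :
    pathGen x n f j ψ i = valleyWeight x j i * blockSum x j i ψ := by
  simp [pathGen, hi, hc, h]

theorem pathGen_eq_zero (h : ¬ (IsPath n f i ∧ i (j + 2) = i j + 1)) :
    pathGen x n f j ψ i = 0 := if_neg h

theorem pathGen_of_blockSum_eq_zero (h : blockSum x j i ψ = 0) : pathGen x n f j ψ i = 0 := by
  simp [pathGen, h]

theorem exists_update_of_pathGen_ne_zero (h : pathGen x n f j ψ i ≠ 0) :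
    IsPath n f i ∧ i (j + 2) = i j + 1 ∧
      ∃ c, (c = i j ∨ c = i j + 1 ∧ 2 * i j < j) ∧ ψ (Function.update i (j + 1) c) ≠ 0 := by
  have hc : IsPath n f i ∧ i (j + 2) = i j + 1 := by
    by_contra hc
    exact h (pathGen_eq_zero hc)
  refine ⟨hc.1, hc.2, ?_⟩
  by_contra! hcon
  refine h (pathGen_of_blockSum_eq_zero ?_)
  rw [blockSum, hcon _ (Or.inl rfl)]
  split_ifs with hlt
  · rw [hcon _ (Or.inr ⟨rfl, hlt⟩)]
    simp
  · simp

theorem update_add_two_apply (c : ℕ) : Function.update i (j + 1 + 1) c j = i j :=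
  Function.update_of_ne (by omega) _ _

theorem blockSum_update (c : ℕ) :
    blockSum x j (Function.update i (j + 1) c) ψ = blockSum x j i ψ := by
  simp [blockSum, peakWeight]

/-- This sum is the trace of the rank-one matrix of `e_{j+1}` on a block, and a rank-one matrix
satisfies `E² = (tr E) E`. -/
theorem peakWeight_add_valleyWeight (hp : ∀ j, p x (j + 1) ≠ 0) :
    peakWeight x j i + valleyWeight x j i = x := by
  rw [peakWeight, valleyWeight, p_succ_succ]
  have := hp (j - 2 * i j)
  field_simp
  ring

/-- Applying the block functional to a function of the form `e_{j+1}`-image. -/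
theorem blockSum_pathGen (hp : ∀ j, p x (j + 1) ≠ 0) (hi : IsPath n f i) (hj : j + 1 < n)
    (hc : i (j + 2) = i j + 1) :
    blockSum x j i (pathGen x n f j ψ) = x * blockSum x j i ψ := by
  conv_lhs => rw [blockSum]
  rw [pathGen_peak (hi.update hj hc (Or.inl rfl)) (by simpa using hc) (by simp), blockSum_update]
  split_ifs with h
  · rw [pathGen_valley (hi.update hj hc (Or.inr ⟨rfl, h⟩)) (by simpa using hc) (by simp),
      blockSum_update]
    have : valleyWeight x j (Function.update i (j + 1) (i j + 1)) = valleyWeight x j i := by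
      simp [valleyWeight]
    rw [this]
    linear_combination blockSum x j i ψ * peakWeight_add_valleyWeight (j := j) (i := i) hp
  -- At height `0` the block has only its peak; since `p_0 = 0` the valley weight vanishes, and the
  -- peak weight alone is `x`.
  · have h0 : valleyWeight x j i = 0 := by
      have : j - 2 * i j = 0 := by omega
      simp [valleyWeight, this, p_zero]
    linear_combination blockSum x j i ψ * (peakWeight_add_valleyWeight (j := j) (i := i) hp - h0)

theorem pathGen_sq (hp : ∀ j, p x (j + 1) ≠ 0) (hj : j + 1 < n) :
    pathGen x n f j (pathGen x n f j ψ) = x • pathGen x n f j ψ := by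
  funext i
  rw [Pi.smul_apply, smul_eq_mul]
  by_cases h : IsPath n f i ∧ i (j + 2) = i j + 1
  · obtain ⟨hi, hc⟩ := h
    rcases hi.step (k := j) (by omega) with h | h
    · rw [pathGen_peak hi hc h, pathGen_peak hi hc h, blockSum_pathGen hp hi hj hc]
    · rw [pathGen_valley hi hc h, pathGen_valley hi hc h, blockSum_pathGen hp hi hj hc]
      ring
  · rw [pathGen_eq_zero h, pathGen_eq_zero h, mul_zero]

/-! ### Neighbouring and distant generators -/

theorem peakWeight_mul_valleyWeight_succ (hp : ∀ j, p x (j + 1) ≠ 0) {i' : ℕ → ℕ}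
    (hi : 2 * i j ≤ j) (h : i' (j + 1) = i j) :
    peakWeight x j i * valleyWeight x (j + 1) i' = 1 := by
  have h₁ : j + 1 - 2 * i j = j - 2 * i j + 1 := by omega
  rw [peakWeight, valleyWeight, h, h₁]
  have := hp (j - 2 * i j)
  have := hp (j - 2 * i j + 1)
  field_simp

theorem valleyWeight_mul_peakWeight_succ (hp : ∀ j, p x (j + 1) ≠ 0) {i' : ℕ → ℕ}
    (hi : 2 * i j < j) (h : i' (j + 1) = i j + 1) :
    valleyWeight x j i * peakWeight x (j + 1) i' = 1 := by
  obtain ⟨m, hm⟩ : ∃ m, j - 2 * i j = m + 1 := ⟨j - 2 * i j - 1, by omega⟩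
  have h₁ : j + 1 - 2 * (i j + 1) = m := by omega
  rw [peakWeight, valleyWeight, h, h₁, hm]
  have := hp m
  have := hp (m + 1)
  field_simp

/-- The entry at `j + 3` decides which member of the block survives `e_{j+2}`: the peak at `j + 1`
if it is followed by a rise, the valley if it is followed by a fall. Only one path contributes at
each stage, and the two weights picked up are reciprocal. -/
theorem blockSum_pathGen_succ (hp : ∀ j, p x (j + 1) ≠ 0) (hi : IsPath n f i) (hj : j + 2 < n)
    (hc : i (j + 2) = i j + 1) :
    blockSum x j i (pathGen x n f (j + 1) (pathGen x n f j ψ)) = blockSum x j i ψ := by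
  conv_lhs => rw [blockSum]
  have hpk := hi.update (by omega) hc (Or.inl rfl)
  rcases hi.step (k := j + 2) hj with h | h <;> change i (j + 1 + 2) = _ at h
  · rw [pathGen_valley hpk (by simp [h, hc]) (by simp [hc])]
    rw [pathGen_eq_zero (i := Function.update i (j + 1) (i j + 1))
      (fun h' => by have := h'.2; simp at this; omega)]
    have hb : blockSum x (j + 1) (Function.update i (j + 1) (i j)) (pathGen x n f j ψ) =
        blockSum x j i ψ := by
      conv_lhs => rw [blockSum]
      have := hi.two_mul_le j
      rw [pathGen_eq_zero (fun h' => by have := h'.2; simp [update_add_two_apply] at this),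
        if_pos (by simp; omega)]
      have h₂ : Function.update (Function.update i (j + 1) (i j)) (j + 1 + 1)
          (Function.update i (j + 1) (i j) (j + 1) + 1) = Function.update i (j + 1) (i j) := by
        rw [Function.update_eq_self_iff]
        simp [hc]
      rw [h₂, pathGen_peak hpk (by simp [hc]) (by simp), blockSum_update]
      ring
    rw [hb, ite_self, add_zero, ← mul_assoc,
      peakWeight_mul_valleyWeight_succ hp (hi.two_mul_le j) (by simp), one_mul]
  · have hlt : 2 * i j < j := by
      have := hi.two_mul_le (j + 1 + 2)
      omega
    have hvl := hi.update (by omega) hc (Or.inr ⟨rfl, hlt⟩)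
    rw [pathGen_eq_zero (fun h' => by have := h'.2; simp at this; omega),
      if_pos hlt,
      pathGen_peak hvl (by simp [h, hc]) (by simp [hc])]
    have hb : blockSum x (j + 1) (Function.update i (j + 1) (i j + 1)) (pathGen x n f j ψ) =
        peakWeight x (j + 1) (Function.update i (j + 1) (i j + 1)) *
          (valleyWeight x j i * blockSum x j i ψ) := by
      conv_lhs => rw [blockSum]
      have h₂ : Function.update (Function.update i (j + 1) (i j + 1)) (j + 1 + 1)
          (Function.update i (j + 1) (i j + 1) (j + 1)) = Function.update i (j + 1) (i j + 1) := by
        rw [Function.update_eq_self_iff]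
        simp [hc]
      rw [h₂, pathGen_valley hvl (by simp [hc]) (by simp), blockSum_update,
        pathGen_eq_zero (fun h' => by have := h'.2; simp [update_add_two_apply] at this)]
      simp [valleyWeight]
    rw [hb]
    have := valleyWeight_mul_peakWeight_succ hp (x := x)
      (i' := Function.update i (j + 1) (i j + 1)) hlt (by simp)
    linear_combination blockSum x j i ψ * this

/-- Mirror image of the preceding argument: now the step from `j` to `j + 1` selects the surviving
member of the block at `j + 2`. -/
theorem blockSum_succ_pathGen (hp : ∀ j, p x (j + 1) ≠ 0) (hi : IsPath n f i) (hj : j + 2 < n)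
    (hc : i (j + 1 + 2) = i (j + 1) + 1) :
    blockSum x (j + 1) i (pathGen x n f j (pathGen x n f (j + 1) ψ)) =
      blockSum x (j + 1) i ψ := by
  conv_lhs => rw [blockSum]
  have hpk := hi.update (j := j + 1) (by omega) hc (Or.inl rfl)
  rcases hi.step (k := j) (by omega) with h | h
  · have hlt : 2 * i (j + 1) < j + 1 := by
      have := hi.two_mul_le j
      omega
    have hvl := hi.update (j := j + 1) (by omega) hc (Or.inr ⟨rfl, hlt⟩)
    rw [pathGen_eq_zero (fun h' => by have := h'.2; simp [update_add_two_apply] at this; omega),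
      if_pos hlt,
      pathGen_peak hvl (by simp [h, update_add_two_apply]) (by simp [h, update_add_two_apply])]
    have hb : blockSum x j (Function.update i (j + 1 + 1) (i (j + 1) + 1))
        (pathGen x n f (j + 1) ψ) =
        peakWeight x j i * (valleyWeight x (j + 1) i * blockSum x (j + 1) i ψ) := by
      conv_lhs => rw [blockSum]
      have h₂ : Function.update (Function.update i (j + 1 + 1) (i (j + 1) + 1)) (j + 1)
          (Function.update i (j + 1 + 1) (i (j + 1) + 1) j) =
            Function.update i (j + 1 + 1) (i (j + 1) + 1) := by
        rw [Function.update_eq_self_iff]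
        simp [h, update_add_two_apply]
      rw [h₂, pathGen_valley hvl (by simp [hc]) (by simp), blockSum_update,
        pathGen_eq_zero (fun h' => by have := h'.2; simp [update_add_two_apply] at this; omega)]
      simp [valleyWeight, peakWeight, update_add_two_apply]
    rw [hb]
    have := peakWeight_mul_valleyWeight_succ hp (x := x) (i' := i) (hi.two_mul_le j) h
    linear_combination blockSum x (j + 1) i ψ * this
  · have hlt : 2 * i j < j := by
      have := hi.two_mul_le (j + 1)
      omega
    rw [pathGen_eq_zero (i := Function.update i (j + 1 + 1) (i (j + 1) + 1))
      (fun h' => by have := h'.2; simp [update_add_two_apply] at this; omega)]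
    rw [pathGen_valley hpk (by simp [h, update_add_two_apply]) (by simp [h, update_add_two_apply])]
    have hb : blockSum x j (Function.update i (j + 1 + 1) (i (j + 1)))
        (pathGen x n f (j + 1) ψ) = blockSum x (j + 1) i ψ := by
      conv_lhs => rw [blockSum]
      have h₂ : Function.update (Function.update i (j + 1 + 1) (i (j + 1))) (j + 1)
          (Function.update i (j + 1 + 1) (i (j + 1)) j + 1) =
            Function.update i (j + 1 + 1) (i (j + 1)) := by
        rw [Function.update_eq_self_iff]
        simp [h, update_add_two_apply]
      rw [h₂, pathGen_peak hpk (by simp [hc]) (by simp), blockSum_update,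
        pathGen_eq_zero (fun h' => by have := h'.2; simp [update_add_two_apply] at this; omega)]
      simp [hlt, update_add_two_apply]
    rw [hb]
    have h₃ := valleyWeight_mul_peakWeight_succ hp (x := x) (i' := i) hlt h
    have h₄ : valleyWeight x j (Function.update i (j + 1 + 1) (i (j + 1))) =
        valleyWeight x j i := by
      simp [valleyWeight, update_add_two_apply]
    rw [h₄, ite_self]
    linear_combination blockSum x (j + 1) i ψ * h₃

/-- As `e_{j+1}` has rank one on each block, it sees its argument only through the block functional;
a relation starting with it is an identity of functionals. -/
theorem pathGen_congr {ψ χ : (ℕ → ℕ) → K} (hj : j + 1 < n)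
    (h : ∀ i, IsPath n f i → i (j + 2) = i j + 1 → blockSum x j i ψ = blockSum x j i χ) :
    pathGen x n f j ψ = pathGen x n f j χ := by
  funext i
  by_cases h' : IsPath n f i ∧ i (j + 2) = i j + 1
  · obtain ⟨hi, hc⟩ := h'
    rcases hi.step (k := j) (by omega) with h₁ | h₁
    · rw [pathGen_peak hi hc h₁, pathGen_peak hi hc h₁, h i hi hc]
    · rw [pathGen_valley hi hc h₁, pathGen_valley hi hc h₁, h i hi hc]
  · rw [pathGen_eq_zero h', pathGen_eq_zero h']

theorem pathGen_neighbour (hp : ∀ j, p x (j + 1) ≠ 0) (hj : j + 2 < n) :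
    pathGen x n f j (pathGen x n f (j + 1) (pathGen x n f j ψ)) = pathGen x n f j ψ :=
  pathGen_congr (by omega) fun _ hi hc => blockSum_pathGen_succ hp hi hj hc

theorem pathGen_succ_neighbour (hp : ∀ j, p x (j + 1) ≠ 0) (hj : j + 2 < n) :
    pathGen x n f (j + 1) (pathGen x n f j (pathGen x n f (j + 1) ψ)) =
      pathGen x n f (j + 1) ψ :=
  pathGen_congr (by omega) fun _ hi hc => blockSum_succ_pathGen hp hi hj hc

/-- Changing the entry at `j + 1` affects none of the entries `l`, `l + 1`, `l + 2`, and conversely,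
so the two operators act on independent coordinates. The cases below record which of the two valleys
exist. -/
theorem pathGen_far {l : ℕ} (hj : j + 1 < n) (hl : l + 1 < n) (hjl : j + 2 ≤ l) :
    pathGen x n f j (pathGen x n f l ψ) = pathGen x n f l (pathGen x n f j ψ) := by
  funext i
  by_cases hi : IsPath n f i
  swap
  · rw [pathGen_eq_zero fun h => hi h.1, pathGen_eq_zero fun h => hi h.1]
  have e₁ : ∀ c, Function.update i (j + 1) c l = i l :=
    fun c => Function.update_of_ne (by omega) _ _
  have e₂ : ∀ c, Function.update i (j + 1) c (l + 1) = i (l + 1) :=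
    fun c => Function.update_of_ne (by omega) _ _
  have e₃ : ∀ c, Function.update i (j + 1) c (l + 2) = i (l + 2) :=
    fun c => Function.update_of_ne (by omega) _ _
  have d₁ : ∀ c, Function.update i (l + 1) c j = i j :=
    fun c => Function.update_of_ne (by omega) _ _
  have d₂ : ∀ c, Function.update i (l + 1) c (j + 1) = i (j + 1) :=
    fun c => Function.update_of_ne (by omega) _ _
  have d₃ : ∀ c, Function.update i (l + 1) c (j + 2) = i (j + 2) :=
    fun c => Function.update_of_ne (by omega) _ _
  have hcomm : ∀ c d, Function.update (Function.update i (j + 1) c) (l + 1) d =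
      Function.update (Function.update i (l + 1) d) (j + 1) c :=
    fun c d => Function.update_comm (by omega) _ _ _
  by_cases hcj : i (j + 2) = i j + 1
  swap
  · have h₀ : ∀ c, pathGen x n f j ψ (Function.update i (l + 1) c) = 0 := fun c =>
      pathGen_eq_zero fun h => hcj (by have := h.2; rwa [d₁, d₃] at this)
    have hb : blockSum x l i (pathGen x n f j ψ) = 0 := by simp [blockSum, h₀]
    rw [pathGen_eq_zero fun h => hcj h.2, pathGen_of_blockSum_eq_zero hb]
  by_cases hcl : i (l + 2) = i l + 1
  swap
  · have h₀ : ∀ c, pathGen x n f l ψ (Function.update i (j + 1) c) = 0 := fun c =>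
      pathGen_eq_zero fun h => hcl (by have := h.2; rwa [e₁, e₃] at this)
    have hb : blockSum x j i (pathGen x n f l ψ) = 0 := by simp [blockSum, h₀]
    rw [pathGen_eq_zero (j := l) fun h => hcl h.2, pathGen_of_blockSum_eq_zero hb]
  have hjp := hi.update hj hcj (Or.inl rfl)
  have hlp := hi.update hl hcl (Or.inl rfl)
  by_cases hj' : 2 * i j < j <;> by_cases hl' : 2 * i l < l
  · have hjv := hi.update hj hcj (Or.inr ⟨rfl, hj'⟩)
    have hlv := hi.update hl hcl (Or.inr ⟨rfl, hl'⟩)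
    simp only [pathGen, LinearMap.coe_mk, AddHom.coe_mk, blockSum, peakWeight, valleyWeight,
      d₁, d₂, d₃, e₁, e₂, e₃, hi, hjp, hlp, hjv, hlv, hcj, hcl, hj', hl', hcomm, and_self, if_true]
    ring
  · have hjv := hi.update hj hcj (Or.inr ⟨rfl, hj'⟩)
    simp only [pathGen, LinearMap.coe_mk, AddHom.coe_mk, blockSum, peakWeight, valleyWeight,
      d₁, d₂, d₃, e₁, e₂, e₃, hi, hjp, hlp, hjv, hcj, hcl, hj', hl', hcomm, and_self, if_true,
      if_false]
    ring
  · have hlv := hi.update hl hcl (Or.inr ⟨rfl, hl'⟩)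
    simp only [pathGen, LinearMap.coe_mk, AddHom.coe_mk, blockSum, peakWeight, valleyWeight,
      d₁, d₂, d₃, e₁, e₂, e₃, hi, hjp, hlp, hlv, hcj, hcl, hj', hl', hcomm, and_self, if_true,
      if_false]
    ring
  · simp only [pathGen, LinearMap.coe_mk, AddHom.coe_mk, blockSum, peakWeight, valleyWeight,
      d₁, d₂, d₃, e₁, e₂, e₃, hi, hjp, hlp, hcj, hcl, hj', hl', hcomm, and_self, if_true, if_false]
    ring

end PathRep

/-! ### Relations between the generators -/

section Generators

variable {K : Type*} [Field K] (x : K) (n : ℕ)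

theorem e_of_lt {i : ℕ} (h : 1 ≤ i ∧ i < n) :
    e x n i = RingQuot.mkAlgHom K (Rel x n) (FreeAlgebra.ι K ⟨i, h⟩) := dif_pos h

theorem e_eq_zero {i : ℕ} (h : ¬ (1 ≤ i ∧ i < n)) : e x n i = 0 := dif_neg h

theorem e_mul_self (i : ℕ) : e x n i * e x n i = x • e x n i := by
  by_cases h : 1 ≤ i ∧ i < n
  · rw [e_of_lt x n h, ← map_mul, RingQuot.mkAlgHom_rel K (Rel.sq (x := x) ⟨i, h⟩), map_smul]
  · simp [e_eq_zero x n h]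

theorem e_mul_e_mul_e {i j : ℕ} (hj : 1 ≤ j ∧ j < n) (hij : i + 1 = j ∨ j + 1 = i) :
    e x n i * e x n j * e x n i = e x n i := by
  by_cases h : 1 ≤ i ∧ i < n
  · rw [e_of_lt x n h, e_of_lt x n hj, ← map_mul, ← map_mul,
      RingQuot.mkAlgHom_rel K (Rel.neighbour (x := x) ⟨i, h⟩ ⟨j, hj⟩ hij)]
  · simp [e_eq_zero x n h]

theorem e_mul_comm {i j : ℕ} (hij : i + 2 ≤ j ∨ j + 2 ≤ i) : Commute (e x n i) (e x n j) := by
  by_cases h : 1 ≤ i ∧ i < n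
  · by_cases h' : 1 ≤ j ∧ j < n
    · rw [Commute, SemiconjBy, e_of_lt x n h, e_of_lt x n h', ← map_mul, ← map_mul,
        RingQuot.mkAlgHom_rel K (Rel.far (x := x) ⟨i, h⟩ ⟨j, h'⟩ hij)]
    · simp [e_eq_zero x n h']
  · simp [e_eq_zero x n h]

end Generators

/-! ### The path representation of the algebra -/

section Representation

variable {K : Type*} [Field K] {x : K} (n f : ℕ)

open MulOpposite in
/-- The right representation of the algebra on functions on paths. -/
def pathRep (hp : ∀ j, p x (j + 1) ≠ 0) :
    TL x n →ₐ[K] (Module.End K ((ℕ → ℕ) → K))ᵐᵒᵖ :=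
  RingQuot.liftAlgHom K
    ⟨FreeAlgebra.lift K fun i : Gen n => op (pathGen x n f (i.1 - 1)), by
      intro a b hab
      cases hab with
      | sq i =>
        obtain ⟨i, hi₁, hi₂⟩ := i
        obtain ⟨j, rfl⟩ : ∃ j, i = j + 1 := ⟨i - 1, by omega⟩
        simp only [map_mul, map_smul, FreeAlgebra.lift_ι_apply, ← op_mul, ← op_smul]
        congr 1
        ext1 ψ
        exact pathGen_sq hp hi₂
      | neighbour i i' h =>
        obtain ⟨i, hi₁, hi₂⟩ := i
        obtain ⟨i', hi₁', hi₂'⟩ := i'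
        obtain ⟨j, rfl⟩ : ∃ j, i = j + 1 := ⟨i - 1, by omega⟩
        obtain ⟨j', rfl⟩ : ∃ j, i' = j + 1 := ⟨i' - 1, by omega⟩
        simp only [map_mul, FreeAlgebra.lift_ι_apply, ← op_mul]
        congr 1
        ext1 ψ
        rcases h with h | h
        · obtain rfl : j' = j + 1 := by simp at h; omega
          exact pathGen_neighbour hp hi₂'
        · obtain rfl : j = j' + 1 := by simp at h; omega
          exact pathGen_succ_neighbour hp hi₂
      | far i i' h =>
        obtain ⟨i, hi₁, hi₂⟩ := i
        obtain ⟨i', hi₁', hi₂'⟩ := i'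
        obtain ⟨j, rfl⟩ : ∃ j, i = j + 1 := ⟨i - 1, by omega⟩
        obtain ⟨j', rfl⟩ : ∃ j, i' = j + 1 := ⟨i' - 1, by omega⟩
        simp only [map_mul, FreeAlgebra.lift_ι_apply, ← op_mul]
        congr 1
        ext1 ψ
        rcases h with h | h
        · exact (pathGen_far hi₂ hi₂' (by simp at h; omega)).symm
        · exact pathGen_far hi₂' hi₂ (by simp at h; omega)⟩

variable {n} (hp : ∀ j, p x (j + 1) ≠ 0)

/-- The right action of the algebra on functions on paths. -/
def pathAct (ψ : (ℕ → ℕ) → K) (a : TL x n) : (ℕ → ℕ) → K := (pathRep n f hp a).unop ψ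

variable {f} (ψ χ : (ℕ → ℕ) → K)

@[simp] theorem pathAct_one : pathAct f hp ψ (1 : TL x n) = ψ := by simp [pathAct]

theorem pathAct_mul (a b : TL x n) :
    pathAct f hp ψ (a * b) = pathAct f hp (pathAct f hp ψ a) b := by simp [pathAct]

@[simp] theorem pathAct_zero : pathAct f hp ψ (0 : TL x n) = 0 := by simp [pathAct]

theorem pathAct_add (a b : TL x n) :
    pathAct f hp ψ (a + b) = pathAct f hp ψ a + pathAct f hp ψ b := by simp [pathAct]

theorem pathAct_sub (a b : TL x n) :
    pathAct f hp ψ (a - b) = pathAct f hp ψ a - pathAct f hp ψ b := by simp [pathAct]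

theorem pathAct_neg (a : TL x n) :
    pathAct f hp ψ (-a) = -pathAct f hp ψ a := by simp [pathAct]

theorem pathAct_smul (c : K) (a : TL x n) :
    pathAct f hp ψ (c • a) = c • pathAct f hp ψ a := by simp [pathAct]

theorem pathAct_sum {ι : Type*} (S : Finset ι) (a : ι → TL x n) :
    pathAct f hp ψ (∑ k ∈ S, a k) = ∑ k ∈ S, pathAct f hp ψ (a k) := by
  simp [pathAct]

theorem smul_pathAct (c : K) (a : TL x n) :
    pathAct f hp (c • ψ) a = c • pathAct f hp ψ a := by simp [pathAct]

theorem pathAct_e {j : ℕ} (hj : j + 1 < n) :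
    pathAct f hp ψ (e x n (j + 1)) = pathGen x n f j ψ := by
  rw [pathAct, e_of_lt x n ⟨by omega, hj⟩, pathRep, RingQuot.liftAlgHom_mkAlgHom_apply]
  simp

end Representation

/-! ### The Jucys–Murphy elements on the path representation -/

section JucysMurphy

variable {K : Type*} [Field K] (x : K)

/-- The eigenvalue `p_i p_{k-i+1}` of `z_k = ∑ x^l T_{k-l}` at a path with entry `i` at `k`. -/
def zEig (k i : ℕ) : K := p x i * p x (k - i + 1)

/-- The eigenvalue of `T_k` at a path. -/
def content (i : ℕ → ℕ) : ℕ → K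
  | 0 => 0
  | k + 1 => zEig x (k + 1) (i (k + 1)) - x * zEig x k (i k)

variable {x}

/-- This is the recursion `z_{m+1} = T_{m+1} + x z_m` for eigenvalues. The eigenvalue of `z_m`
depends only on the shape at `m`, which is why `content` is defined through `zEig`. -/
theorem sum_content {i : ℕ → ℕ} (h0 : i 0 = 0) (m : ℕ) :
    ∑ k ∈ Finset.range (m + 1), x ^ k * content x i (m - k) = zEig x m (i m) := by
  induction m with
  | zero => simp [content, zEig, h0, p_zero]
  | succ m ih =>
    rw [Finset.sum_range_succ']
    have : ∀ k ∈ Finset.range (m + 1), x ^ (k + 1) * content x i (m + 1 - (k + 1)) =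
        x * (x ^ k * content x i (m - k)) := fun k _ => by
      rw [Nat.add_sub_add_right]
      ring
    rw [Finset.sum_congr rfl this, ← Finset.mul_sum, ih]
    simp [content]

theorem content_eq_r {n : ℕ} {lam : Ptn n} (t : Tableau n lam) {k : ℕ} (hk : k ≤ n) :
    r x t k = content x t.row k := by
  have ht := t.isPath
  rw [r]
  rcases k with _ | k
  · simp [content]
  rcases k with _ | k
  · have h₁ := ht.two_mul_le 1
    have h₁' : t.row 1 = 0 := by omega
    simp [content, zEig, ht.zero, h₁', p_zero]
  rw [if_neg (by omega), content, zEig, zEig, Nat.add_sub_cancel]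
  have := ht.two_mul_le (k + 1)
  rcases ht.step (k := k + 1) (by omega) with h | h
  · rw [if_neg (by omega), h]
    have h₂ : k + 1 + 1 - t.row (k + 1) = k + 1 - t.row (k + 1) + 1 := by omega
    rw [h₂]
    ring
  · rw [if_pos h.symm, h, Nat.add_sub_cancel]
    have h₂ : k + 1 + 1 - (t.row (k + 1) + 1) = k + 1 - t.row (k + 1) := by omega
    rw [h₂]
    ring

/-- The combination of operators which defines `T_{k+3}` is diagonal on paths if `T_{k+2}` is. -/
theorem jm_recursion_apply (hp : ∀ j, p x (j + 1) ≠ 0) {n f k : ℕ} (hk : k + 2 < n)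
    {D : ((ℕ → ℕ) → K) → ((ℕ → ℕ) → K)}
    (hD : ∀ ψ i, IsPath n f i → D ψ i = content x i (k + 2) * ψ i) (ψ : (ℕ → ℕ) → K)
    {i : ℕ → ℕ} (hi : IsPath n f i) :
    -D (pathGen x n f (k + 1) ψ) i - pathGen x n f (k + 1) (D ψ) i +
      pathGen x n f (k + 1) (D (pathGen x n f k (pathGen x n f (k + 1) ψ))) i -
      zEig x (k + 1) (i (k + 1)) * ψ i -
      zEig x k (i k) * pathGen x n f (k + 1) ψ i = content x i (k + 3) * ψ i := by
  rw [hD _ _ hi]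
  have hle := hi.two_mul_le (k + 1)
  have hle₀ := hi.two_mul_le k
  by_cases hc : i (k + 1 + 2) = i (k + 1) + 1
  swap
  -- Two equal steps in a row: all terms ending in `e_{k+2}` vanish and `T_{k+3}` acts as
  -- `-z_{k+1}`.
  · rw [pathGen_eq_zero fun h => hc h.2, pathGen_eq_zero fun h => hc h.2,
      pathGen_eq_zero fun h => hc h.2]
    simp only [mul_zero, neg_zero, sub_zero, zero_sub, add_zero, content]
    rw [← neg_mul]
    congr 1
    rcases hi.step (k := k + 1) (by omega) with h₁ | h₁ <;>
    rcases hi.step (k := k + 2) hk with h₂ | h₂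
    · obtain ⟨d, hd⟩ : ∃ d, k + 1 - i (k + 1) = d := ⟨_, rfl⟩
      have e₁ : i (k + 2 + 1) = i (k + 1) := by rw [h₂]; exact h₁
      have e₂ : i (k + 2) = i (k + 1) := h₁
      rw [e₁, e₂, zEig, zEig, zEig, show k + 2 + 1 - i (k + 1) = d + 2 by omega,
        show k + 2 - i (k + 1) = d + 1 by omega, hd, p_succ_succ x (d + 1)]
      ring
    · exact absurd (by rw [h₁] at h₂; exact h₂) hc
    · exact absurd (by rw [h₁] at h₂; exact h₂) hc
    · obtain ⟨d, hd⟩ : ∃ d, k + 1 - i (k + 1) = d := ⟨_, rfl⟩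
      have e₂ : i (k + 2) = i (k + 1) + 1 := h₁
      have e₁ : i (k + 2 + 1) = i (k + 1) + 2 := by rw [h₂, e₂]
      have := hi.two_mul_le (k + 2 + 1)
      rw [e₁, e₂, zEig, zEig, zEig, show k + 2 + 1 - (i (k + 1) + 2) + 1 = d + 1 by omega,
        show k + 2 - (i (k + 1) + 1) + 1 = d + 1 by omega, hd, p_succ_succ x (i (k + 1))]
      ring
  obtain ⟨a, ha⟩ : ∃ a, i (k + 1) = a := ⟨_, rfl⟩
  obtain ⟨H, hH⟩ : ∃ H, k + 1 = H + 2 * a := ⟨k + 1 - 2 * a, by omega⟩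
  have hpk := hi.update (j := k + 1) hk hc (Or.inl rfl)
  set tp := Function.update i (k + 1 + 1) (i (k + 1)) with htp
  set tv := Function.update i (k + 1 + 1) (i (k + 1) + 1) with htv
  set cp : K := -(p x a * p x (H + a)) with hcp
  set cv : K := (p x (a + 1) - x * p x a) * p x (H + a + 1) with hcv
  have hctp : content x tp (k + 2) = cp := by
    have e₁ : tp (k + 1 + 1) = a := by simp [htp, ha]
    have e₂ : tp (k + 1) = a := by simp [htp, ha]
    rw [content, e₁, e₂, zEig, zEig, show k + 1 + 1 - a + 1 = H + a + 2 by omega,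
      show k + 1 - a + 1 = H + a + 1 by omega, p_succ_succ x (H + a), hcp]
    ring
  have hctv : content x tv (k + 2) = cv := by
    have e₁ : tv (k + 1 + 1) = a + 1 := by simp [htv, ha]
    have e₂ : tv (k + 1) = a := by simp [htv, ha]
    rw [content, e₁, e₂, zEig, zEig, show k + 1 + 1 - (a + 1) + 1 = H + a + 1 by omega,
      show k + 1 - a + 1 = H + a + 1 by omega, hcv]
    ring
  -- `cp` and `cv` are the eigenvalues of `T_{k+2}` at the peak and the valley of the block, and `H`
  -- is the height at `k + 1`.
  have hdiff : cv - cp = p x (H + 1) := by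
    have h₁ := p_mul_sub_p_mul x (H + 1) a
    have h₂ := p_succ_succ x (H + a)
    rw [show H + 1 + a = H + a + 1 by omega] at h₁
    rw [hcv, hcp]
    linear_combination h₁ + p x a * h₂
  set E := pathGen x n f (k + 1) ψ with hE
  set X := blockSum x (k + 1) i ψ with hX
  have hbs : ∀ χ, blockSum x (k + 1) i χ = peakWeight x (k + 1) i * χ tp +
      if 2 * i (k + 1) < k + 1 then χ tv else 0 := fun χ => rfl
  have hbD : ∀ χ, blockSum x (k + 1) i (D χ) = peakWeight x (k + 1) i * (cp * χ tp) +
      if 2 * i (k + 1) < k + 1 then cv * χ tv else 0 := by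
    intro χ
    rw [hbs, hD _ _ hpk, hctp]
    split_ifs with h
    · rw [hD _ _ (hi.update (j := k + 1) hk hc (Or.inr ⟨rfl, h⟩)), hctv]
    · rfl
  -- The step into `k + 1` leaves one of `tp`, `tv` in the image of `e_{k+1}`, and by the neighbour
  -- relation that one carries all of `X`. It contributes its own eigenvalue, while `z_k`
  -- contributes minus the eigenvalue of the other, so both cases give `cp + cv`.
  have hcomb : blockSum x (k + 1) i (D (pathGen x n f k E)) - zEig x k (i k) * X =
      (cp + cv) * X := by
    have hX' : blockSum x (k + 1) i (pathGen x n f k E) = X := blockSum_succ_pathGen hp hi hk hc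
    rw [hbs] at hX'
    rw [hbD]
    rcases hi.step (k := k) (by omega) with h | h
    · have h0 : pathGen x n f k E tp = 0 :=
        pathGen_eq_zero fun h' => by
          have := h'.2
          simp [htp, update_add_two_apply] at this
          omega
      rw [h0] at hX' ⊢
      have hlt : 2 * i (k + 1) < k + 1 := by omega
      rw [if_pos hlt] at hX' ⊢
      have hz : zEig x k (i k) = -cp := by
        rw [← h, ha, zEig, hcp, show k - a + 1 = H + a by omega]
        ring
      rw [hz]
      linear_combination cv * hX'
    · have h0 : pathGen x n f k E tv = 0 :=
        pathGen_eq_zero fun h' => by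
          have := h'.2
          simp [htv, update_add_two_apply] at this
          omega
      rw [h0] at hX' ⊢
      have hz : zEig x k (i k) = -cv := by
        have ha' : a = i k + 1 := by omega
        rw [zEig, hcv, ha', p_succ_succ x (i k), show k - i k + 1 = H + (i k + 1) + 1 by omega]
        ring
      rw [hz]
      simp only [ite_self, add_zero, mul_zero] at hX' ⊢
      linear_combination cp * hX'
  have hXdef := hbs ψ
  rw [← hX] at hXdef
  have hzk : zEig x (k + 1) (i (k + 1)) = p x a * p x (H + a + 1) := by
    rw [zEig, ha, show k + 1 - a + 1 = H + a + 1 by omega]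
  have hpH := hp H
  rcases hi.step (k := k + 1) (by omega) with h | h
  · have hti : tp = i := by rw [htp, ← h, Function.update_eq_self]
    rw [hE, pathGen_peak hi hc h, pathGen_peak hi hc h, pathGen_peak hi hc h, ← hE, ← hX, hzk]
    have hci : content x i (k + 2) = cp := by rw [← hti, hctp]
    have hpw : peakWeight x (k + 1) i * (cv - cp) = p x (H + 2) := by
      rw [hdiff, peakWeight, ha, show k + 1 - 2 * a = H by omega]
      field_simp
    have hc3 : content x i (k + 3) = p x (H + 2) - p x a * p x (H + a + 1) := by
      have e₁ : i (k + 2 + 1) = a + 1 := by rw [← ha]; exact hc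
      have e₂ : i (k + 2) = a := by rw [← ha]; exact h
      have h₁ := p_mul_sub_p_mul x (H + 2) a
      rw [show H + 2 + a = H + a + 2 by omega, p_succ_succ x (H + a + 1)] at h₁
      rw [content, e₁, e₂, zEig, zEig, show k + 2 + 1 - (a + 1) + 1 = H + a + 2 by omega,
        show k + 2 - a + 1 = H + a + 2 by omega]
      linear_combination h₁
    rw [hci, hc3, hbD]
    rw [hti] at hXdef ⊢
    split_ifs at hXdef ⊢
    · linear_combination hcomb + cv * hXdef + ψ i * hpw
    · linear_combination hcomb + cv * hXdef + ψ i * hpw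
  · have hti : tv = i := by rw [htv, ← h, Function.update_eq_self]
    have hlt : 2 * i (k + 1) < k + 1 := by
      have := hi.two_mul_le (k + 1 + 1)
      omega
    rw [hE, pathGen_valley hi hc h, pathGen_valley hi hc h, pathGen_valley hi hc h, ← hE, ← hX,
      hzk]
    have hci : content x i (k + 2) = cv := by rw [← hti, hctv]
    have hvw : valleyWeight x (k + 1) i * (cv - cp) = p x H := by
      rw [hdiff, valleyWeight, ha, show k + 1 - 2 * a = H by omega]
      field_simp
    have hc3 : content x i (k + 3) = -p x H - p x a * p x (H + a + 1) := by
      have e₁ : i (k + 2 + 1) = a + 1 := by rw [← ha]; exact hc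
      have e₂ : i (k + 2) = a + 1 := by rw [← ha]; exact h
      have h₁ := p_mul_sub_p_mul x H a
      have h₂ := p_succ_succ x (H + a)
      rw [content, e₁, e₂, zEig, zEig, show k + 2 + 1 - (a + 1) + 1 = H + a + 2 by omega,
        show k + 2 - (a + 1) + 1 = H + a + 1 by omega]
      linear_combination p x (a + 1) * h₂ - h₁
    rw [hci, hc3, hbD]
    rw [if_pos hlt] at hXdef ⊢
    rw [hti] at hXdef ⊢
    linear_combination valleyWeight x (k + 1) i * hcomb + valleyWeight x (k + 1) i * cp * hXdef -
      ψ i * hvw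

theorem pathAct_JM (hp : ∀ j, p x (j + 1) ≠ 0) {n f k : ℕ} (hk : k ≤ n) (ψ : (ℕ → ℕ) → K)
    {i : ℕ → ℕ} (hi : IsPath n f i) :
    pathAct f hp ψ (JM x n k) i = content x i k * ψ i := by
  induction k using Nat.strong_induction_on generalizing ψ i with
  | _ k ih =>
    have hz : ∀ m < k, m ≤ n → ∀ (ψ : (ℕ → ℕ) → K) {i : ℕ → ℕ}, IsPath n f i →
        pathAct f hp ψ (∑ l ∈ Finset.range (m + 1), x ^ l • JM x n (m - l)) i =
          zEig x m (i m) * ψ i := by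
      intro m hm hmn ψ i hi
      rw [pathAct_sum, Finset.sum_apply, ← sum_content hi.zero, Finset.sum_mul]
      refine Finset.sum_congr rfl fun l _ => ?_
      rw [pathAct_smul, Pi.smul_apply, smul_eq_mul, ih _ (by omega) (by omega) _ hi]
      ring
    match k, hk, ih, hz with
    | 0, _, _, _ => simp [JM, content]
    | 1, _, _, _ =>
      have h₁ := hi.two_mul_le 1
      have h₁' : i 1 = 0 := by omega
      simp [JM, content, zEig, hi.zero, h₁', p_zero]
    | 2, hk, _, _ =>
      rw [JM, pathAct_e hp ψ (j := 0) hk]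
      have h₁ := hi.two_mul_le 1
      have h₁' : i 1 = 0 := by omega
      have h₀ := hi.zero
      have h₂ := hi.two_mul_le 2
      by_cases h : i 2 = 1
      · rw [pathGen_peak hi (by simp [h, h₀]) (by simp [h₁', h₀])]
        have hu : Function.update i 1 0 = i := by
          rw [← h₁', Function.update_eq_self]
        simp [blockSum, peakWeight, content, zEig, h, h₁', h₀, p_two, p_zero, p_one, hu]
      · have h' : i 2 = 0 := by omega
        rw [pathGen_eq_zero (fun hh => by have := hh.2; simp [h', h₀] at this)]
        simp [content, zEig, h', h₁', p_zero]
    | k + 3, hk, ih, hz =>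
      rw [JM, pathAct_sub, pathAct_sub, pathAct_add, pathAct_sub, pathAct_neg, pathAct_mul,
        pathAct_mul, pathAct_mul, pathAct_mul, pathAct_mul, pathAct_mul]
      simp only [Pi.sub_apply, Pi.add_apply, Pi.neg_apply]
      rw [hz (k + 1) (by omega) (by omega) _ hi, hz k (by omega) (by omega) _ hi]
      have he : ∀ ψ, pathAct f hp ψ (e x n (k + 1)) = pathGen x n f k ψ :=
        fun ψ => pathAct_e hp ψ (by omega)
      have he' : ∀ ψ, pathAct f hp ψ (e x n (k + 2)) = pathGen x n f (k + 1) ψ :=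
        fun ψ => pathAct_e hp ψ (by omega)
      simp only [he, he']
      exact jm_recursion_apply hp (by omega) (D := fun ψ => pathAct f hp ψ (JM x n (k + 2)))
        (fun ψ i hi => ih (k + 2) (by omega) (by omega) ψ hi) ψ hi

end JucysMurphy

/-! ### The projections on the path representation -/

section Projections

variable {K : Type*} [Field K] {x : K} (hp : ∀ j, p x (j + 1) ≠ 0) {n f : ℕ}

theorem pathAct_aeval_JM {k : ℕ} (hk : k ≤ n) (q : Polynomial K) (ψ : (ℕ → ℕ) → K)
    {i : ℕ → ℕ} (hi : IsPath n f i) :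
    pathAct f hp ψ (Polynomial.aeval (JM x n k) q) i = q.eval (content x i k) * ψ i := by
  induction q using Polynomial.induction_on' with
  | add q₁ q₂ h₁ h₂ =>
    rw [map_add, pathAct_add, Pi.add_apply, h₁, h₂, Polynomial.eval_add]
    ring
  | monomial m c =>
    rw [Polynomial.aeval_monomial, ← Algebra.smul_def, pathAct_smul, Pi.smul_apply, smul_eq_mul,
      Polynomial.eval_monomial, mul_assoc]
    congr 1
    induction m with
    | zero => simp
    | succ m ih =>
      rw [pow_succ, pathAct_mul, pathAct_JM hp hk _ hi, ih]
      ring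

theorem pathAct_list_prod {ι : Type*} (L : List ι) (a : ι → TL x n) (c : ι → K) {i : ℕ → ℕ}
    (h : ∀ k ∈ L, ∀ ψ, pathAct f hp ψ (a k) i = c k * ψ i) (ψ : (ℕ → ℕ) → K) :
    pathAct f hp ψ (L.map a).prod i = (L.map c).prod * ψ i := by
  induction L generalizing ψ with
  | nil => simp
  | cons k L ih =>
    rw [List.map_cons, List.prod_cons, pathAct_mul, ih (fun k hk => h k (List.mem_cons_of_mem _ hk)),
      h k List.mem_cons_self, List.map_cons, List.prod_cons]
    ring

/-- The path truncated at `k` is the row sequence of a tableau of size `k` with the same content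
there. -/
theorem content_mem_contents {i : ℕ → ℕ} (hi : IsPath n f i) {k : ℕ} (hk : k ≤ n) :
    content x i k ∈ contents x k := by
  classical
  have hle := hi.two_mul_le k
  let mu : Ptn k := ⟨⟨i k, by omega⟩, hle⟩
  have htr : IsPath k mu.fst (fun l => if l ≤ k then i l else 0) := by
    refine ⟨?_, ?_, ?_, ?_, ?_⟩
    · simp [hi.zero]
    · intro l hl
      dsimp only
      rw [if_pos (show l + 1 ≤ k by omega), if_pos (show l ≤ k by omega)]
      exact hi.step (by omega)
    · intro l
      have := hi.two_mul_le l
      dsimp only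
      split_ifs <;> omega
    · exact if_pos le_rfl
    · intro l hl
      dsimp only
      rw [if_neg (by omega)]
  obtain ⟨t, ht⟩ := Tableau.exists_row_eq htr
  refine Finset.mem_image.mpr ⟨⟨mu, t⟩, Finset.mem_univ _, ?_⟩
  dsimp only
  rw [content_eq_r t le_rfl, ht]
  rcases k with _ | k
  · rfl
  · simp [content]

theorem zEig_sub_zEig {k a : ℕ} (h : 2 * a ≤ k) :
    zEig x (k + 1) (a + 1) - zEig x (k + 1) a = p x (k + 1 - 2 * a) := by
  rw [zEig, zEig, ← p_mul_sub_p_mul x (k + 1 - 2 * a) a,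
    show k + 1 - (a + 1) + 1 = k + 1 - 2 * a + a by omega,
    show k + 1 - a + 1 = k + 1 - 2 * a + a + 1 by omega]

-- Contents separate paths: once the entry at `k` is known, the two possible next entries give
-- contents differing by `p_{k+1-2i_k}`, which is nonzero. Starting at `k = 2` is harmless, since
-- the entries at `0` and `1` are forced to be `0`.
include hp in
theorem IsPath.eq_of_content_eq {f' : ℕ} {i i' : ℕ → ℕ} (hi : IsPath n f i) (hi' : IsPath n f' i')
    (h : ∀ k, 2 ≤ k → k ≤ n → content x i k = content x i' k) : i = i' := by
  funext k
  by_cases hk : n < k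
  · rw [hi.eq_zero hk, hi'.eq_zero hk]
  push Not at hk
  induction k with
  | zero => rw [hi.zero, hi'.zero]
  | succ k ih =>
    have hik := ih (by omega)
    rcases k with _ | k
    · have h₁ := hi.two_mul_le (0 + 1)
      have h₂ := hi'.two_mul_le (0 + 1)
      omega
    have hc := h (k + 1 + 1) (by omega) hk
    rw [content, content, hik] at hc
    have hz := zEig_sub_zEig (x := x) (hi'.two_mul_le (k + 1))
    have hne : p x (k + 1 + 1 - 2 * i' (k + 1)) ≠ 0 := by
      have := hi'.two_mul_le (k + 1)
      obtain ⟨m, hm⟩ : ∃ m, k + 1 + 1 - 2 * i' (k + 1) = m + 1 := ⟨k + 1 - 2 * i' (k + 1), by omega⟩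
      rw [hm]
      exact hp m
    rcases hi.step (k := k + 1) (by omega) with h₁ | h₁ <;>
    rcases hi'.step (k := k + 1) (by omega) with h₂ | h₂
    · rw [h₁, h₂, hik]
    · rw [h₁, h₂, hik] at hc
      exact absurd (by rw [← hz]; linear_combination -hc) hne
    · rw [h₁, h₂, hik] at hc
      exact absurd (by rw [← hz]; linear_combination hc) hne
    · rw [h₁, h₂, hik]

-- At `t` every normalised factor is `1`. At `s ≠ t` some content differs, and it occurs among the
-- roots of the corresponding factor.
open Classical in
theorem pathAct_proj {lam : Ptn n} (t s : Tableau n lam) (ψ : (ℕ → ℕ) → K) :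
    pathAct lam.fst hp ψ (proj x t) s.row = if s = t then ψ t.row else 0 := by
  rw [proj, pathAct_list_prod hp _ _ (fun k => Polynomial.eval (content x s.row k)
    (∏ c ∈ (contents x k).erase (r x t k),
      Polynomial.C (r x t k - c)⁻¹ * (Polynomial.X - Polynomial.C c)))
    (fun k hk ψ => pathAct_aeval_JM hp (by rw [List.mem_range'_1] at hk; omega) _ ψ s.isPath)]
  simp only [Polynomial.eval_prod, Polynomial.eval_mul, Polynomial.eval_C, Polynomial.eval_sub,
    Polynomial.eval_X]
  split_ifs with hst
  · subst hst
    rw [List.prod_eq_one, one_mul]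
    intro c hc
    obtain ⟨k, hk, rfl⟩ := List.mem_map.mp hc
    rw [List.mem_range'_1] at hk
    refine Finset.prod_eq_one fun c hc => ?_
    rw [content_eq_r s (by omega)] at hc ⊢
    exact inv_mul_cancel₀ (sub_ne_zero.mpr (Finset.ne_of_mem_erase hc).symm)
  · have : ∃ k, (2 ≤ k ∧ k ≤ n) ∧ content x s.row k ≠ content x t.row k := by
      by_contra! hcon
      exact hst (Tableau.row_injective
        (s.isPath.eq_of_content_eq hp t.isPath fun k h₁ h₂ => hcon k ⟨h₁, h₂⟩))
    obtain ⟨k, ⟨hk₁, hk₂⟩, hne⟩ := this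
    rw [List.prod_eq_zero, zero_mul]
    refine List.mem_map.mpr ⟨k, List.mem_range'_1.mpr ⟨hk₁, by omega⟩, ?_⟩
    refine Finset.prod_eq_zero
      (Finset.mem_erase.mpr ⟨?_, content_mem_contents s.isPath hk₂⟩) (by simp)
    rwa [content_eq_r t hk₂]

end Projections

/-! ### The ideal acts by zero -/

section Ideal

variable {K : Type*} [Field K] {x : K} (hp : ∀ j, p x (j + 1) ≠ 0) {n f : ℕ}

variable (x n) in
/-- The product `e_1 e_3 ⋯ e_{2f-1}`. -/
def oddProd (f : ℕ) : TL x n := ((List.range f).map fun j => e x n (2 * j + 1)).prod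

theorem oddProd_zero : oddProd x n 0 = 1 := rfl

theorem oddProd_succ (f : ℕ) : oddProd x n (f + 1) = oddProd x n f * e x n (2 * f + 1) := by
  simp [oddProd, List.range_succ]

/-- The last factor `e_{2g-1}` forces a peak or valley at `2g - 1`, and changing that entry leaves
the earlier even entries alone; by induction the path has fallen `g` times within its first `2g`
steps. -/
theorem pathAct_oddProd_ne_zero {g : ℕ} (hg : 2 * g ≤ n) {ψ : (ℕ → ℕ) → K} {i : ℕ → ℕ}
    (hi : IsPath n f i) (h : pathAct f hp ψ (oddProd x n g) i ≠ 0) : i (2 * g) = g := by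
  induction g generalizing i with
  | zero => exact hi.zero
  | succ g ih =>
    rw [oddProd_succ, pathAct_mul, pathAct_e hp _ (by omega)] at h
    obtain ⟨-, hc, c, hcc, hψ⟩ := exists_update_of_pathGen_ne_zero h
    have hval : i (2 * g) = g := by
      simpa using ih (by omega) (hi.update (by omega) hc hcc) hψ
    rw [show 2 * (g + 1) = 2 * g + 2 by ring, hc, hval]

/-- A path ending at `f < g` cannot have entry `g` at `2g`. Hence the higher ideals act by zero and
the representation descends to the quotient. -/
theorem pathRep_oddProd_eq_zero {g : ℕ} (hg : 2 * g ≤ n) (hfg : f < g) :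
    pathRep n f hp (oddProd x n g) = 0 := by
  apply MulOpposite.unop_injective
  refine LinearMap.ext fun ψ => funext fun i => ?_
  change pathAct f hp ψ (oddProd x n g) i = 0
  by_contra hne
  by_cases hi : IsPath n f i
  · have h₁ := pathAct_oddProd_ne_zero hp hg hi hne
    have h₂ := hi.mono hg le_rfl
    have h₃ := hi.last
    omega
  · obtain ⟨g, rfl⟩ : ∃ g', g = g' + 1 := ⟨g - 1, by omega⟩
    rw [oddProd_succ, pathAct_mul, pathAct_e hp _ (by omega)] at hne
    exact hne (pathGen_eq_zero fun h => hi h.1)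

theorem upperIdeal_le_ker (lam : Ptn n) :
    upperIdeal x lam ≤ TwoSidedIdeal.ker (pathRep n lam.fst hp) := by
  refine iSup₂_le fun mu hmu => ?_
  rw [TwoSidedIdeal.span_le, Set.singleton_subset_iff, SetLike.mem_coe, TwoSidedIdeal.mem_ker]
  exact pathRep_oddProd_eq_zero hp mu.2 hmu

theorem pathAct_of_mem_upperIdeal {lam : Ptn n} {a : TL x n} (ha : a ∈ upperIdeal x lam)
    (ψ : (ℕ → ℕ) → K) : pathAct lam.fst hp ψ a = 0 := by
  have h : pathRep n lam.fst hp a = 0 := (TwoSidedIdeal.mem_ker _).mp (upperIdeal_le_ker hp lam ha)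
  rw [pathAct, h]
  rfl

end Ideal

/-! ### The elements `w` and `v` -/

section Elements

variable {K : Type*} [Field K] (x : K) (n : ℕ)

theorem w_self (a : ℕ) : w x n a a = 1 := by simp [w]

theorem w_succ {a b : ℕ} (h : a ≤ b) : w x n a (b + 1) = w x n a b * e x n b := by
  rcases h.eq_or_lt with rfl | h
  · simp [w]
  · rw [w, if_pos (by omega), w, if_pos h, show b + 1 - a = b - a + 1 by omega,
      List.range'_concat, List.map_append, List.prod_append]
    simp [show a + (b - a) = b by omega]

/-- The element `v` attached to the first `k` steps of a row sequence. -/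
def vSeq (i : ℕ → ℕ) : ℕ → TL x n
  | 0 => 1
  | k + 1 => if i k = i (k + 1) then vSeq i k else w x n (2 * i (k + 1)) (k + 1) * vSeq i k

variable {n} in
theorem vUpTo_eq_vSeq {lam : Ptn n} (t : Tableau n lam) (k : ℕ) :
    vUpTo x t k = vSeq x n t.row k := by
  induction k with
  | zero => rfl
  | succ k ih => rw [vUpTo, vSeq, ih]

theorem vSeq_congr {i i' : ℕ → ℕ} {k : ℕ} (h : ∀ l ≤ k, i l = i' l) :
    vSeq x n i k = vSeq x n i' k := by
  induction k with
  | zero => rfl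
  | succ k ih =>
    rw [vSeq, vSeq, ih fun l hl => h l (by omega), h k (by omega), h (k + 1) le_rfl]

end Elements

/-! ### Triangularity -/

section Triangular

variable {K : Type*} [Field K] {x : K} (hp : ∀ j, p x (j + 1) ≠ 0) {n f : ℕ}

/-- The function `ψ` has value `1` at `i`, and its support on paths lies above `i`. -/
def IsLeading (n f : ℕ) (ψ : (ℕ → ℕ) → K) (i : ℕ → ℕ) : Prop :=
  ψ i = 1 ∧ ∀ s, IsPath n f s → ψ s ≠ 0 → ∀ k, i k ≤ s k

/-- The column and row of `e_{j+1}` are normalised so that turning a valley into the peak of its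
block has coefficient `1`; this keeps leading coefficients equal to `1`. -/
theorem IsLeading.pathGen {ψ : (ℕ → ℕ) → K} {i : ℕ → ℕ} (h : IsLeading n f ψ i)
    (hi : IsPath n f i) {j : ℕ} (hj : j + 1 < n) (h₁ : i (j + 1) = i j + 1)
    (h₂ : i (j + 2) = i j + 1) :
    IsLeading n f (pathGen x n f j ψ) (Function.update i (j + 1) (i j)) := by
  have hpk := hi.update hj h₂ (Or.inl rfl)
  have hle := hi.two_mul_le (j + 1)
  constructor
  · rw [pathGen_peak hpk (by simpa using h₂) (by simp), blockSum_update, blockSum,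
      if_pos (by omega), ← h₁, Function.update_eq_self, h.1]
    -- The peak lies strictly below `i` at `j + 1`, hence outside the support of `ψ`.
    have : ψ (Function.update i (j + 1) (i j)) = 0 := by
      by_contra hne
      have := h.2 _ hpk hne (j + 1)
      simp at this
      omega
    rw [this, mul_zero, zero_add]
  · intro s hs hne k
    obtain ⟨-, hc, c, hcc, hψ⟩ := exists_update_of_pathGen_ne_zero hne
    have hk := h.2 _ (hs.update hj hc hcc) hψ
    have hstep := hs.step (k := j) (by omega)
    by_cases hkj : k = j + 1
    · subst hkj
      have h₃ := hk (j + 1)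
      have h₄ := hk j
      simp at h₃ h₄ ⊢
      omega
    · have := hk k
      rw [Function.update_of_ne hkj] at this ⊢
      exact this

/-- The path that agrees with `i` from `k` on and is maximal before. -/
def cutPath (i : ℕ → ℕ) (k : ℕ) : ℕ → ℕ := fun j => if j < k then min (j / 2) (i k) else i j

/-- The paths between `cutPath i (k + 1)` and `cutPath i k`, if `i (k + 1) = g + 1 = i k + 1`. -/
def midPath (i : ℕ → ℕ) (k g l : ℕ) : ℕ → ℕ :=
  fun j => if j < l then min (j / 2) g else if j < k + 1 then g + 1 else i j

theorem isPath_midPath {i : ℕ → ℕ} (hi : IsPath n f i) {k g l : ℕ} (hk : k < n)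
    (h₁ : i (k + 1) = g + 1) (hl : 2 * (g + 1) ≤ l) (hlk : l ≤ k + 1) :
    IsPath n f (midPath i k g l) := by
  refine ⟨?_, ?_, ?_, ?_, ?_⟩
  · simp only [midPath]
    rw [if_pos (by omega)]
    omega
  · intro m hm
    have hs := hi.step hm
    have h₂ : m = k → i (m + 1) = g + 1 := by rintro rfl; exact h₁
    simp only [midPath]
    split_ifs <;> omega
  · intro m
    have hs := hi.two_mul_le m
    simp only [midPath]
    split_ifs <;> omega
  · simp only [midPath]
    rw [if_neg (by omega), if_neg (by omega), hi.last]
  · intro m hm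
    simp only [midPath]
    rw [if_neg (by omega), if_neg (by omega), hi.eq_zero hm]

/-- Each factor `e_l` of `w` delays the fall to row `g + 1` from position `l` to `l + 1`, by
flattening a valley at `l` into a peak. -/
theorem IsLeading.pathAct_w {ψ : (ℕ → ℕ) → K} {i : ℕ → ℕ} (hi : IsPath n f i) {k g l : ℕ}
    (hk : k < n) (h₁ : i (k + 1) = g + 1) (hl : 2 * (g + 1) ≤ l) (hlk : l ≤ k + 1)
    (h : IsLeading n f ψ (midPath i k g (2 * (g + 1)))) :
    IsLeading n f (pathAct f hp ψ (w x n (2 * (g + 1)) l)) (midPath i k g l) := by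
  induction l, hl using Nat.le_induction with
  | base => simpa [w_self] using h
  | succ l hl ih =>
    obtain ⟨j, rfl⟩ : ∃ j, l = j + 1 := ⟨l - 1, by omega⟩
    have hm := ih (by omega)
    have e₀ : midPath i k g (j + 1) j = g := by
      simp only [midPath]
      rw [if_pos (by omega)]
      omega
    have e₁ : midPath i k g (j + 1) (j + 1) = g + 1 := by
      simp only [midPath]
      rw [if_neg (by omega), if_pos (by omega)]
    have e₂ : midPath i k g (j + 1) (j + 2) = g + 1 := by
      have h₂ : j + 2 = k + 1 → i (j + 2) = g + 1 := by
        intro hjk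
        rw [hjk, h₁]
      simp only [midPath]
      split_ifs <;> omega
    rw [w_succ x n hl, pathAct_mul, pathAct_e hp _ (by omega)]
    have := hm.pathGen (x := x) (isPath_midPath hi hk h₁ hl (by omega)) (j := j) (by omega)
      (by rw [e₀, e₁]) (by rw [e₀, e₂])
    rw [e₀] at this
    convert! this using 1
    funext m
    by_cases hmj : m = j + 1
    · subst hmj
      rw [Function.update_self]
      simp only [midPath]
      rw [if_pos (by omega)]
      omega
    · rw [Function.update_of_ne hmj]
      simp only [midPath]
      split_ifs <;> omega

/-- In a right action `v_t = u_n ⋯ u_1` applies `u_n` first, so the steps of `i` are installed from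
the end: `u_{k+1}` carries `cutPath i (k + 1)` to `cutPath i k`. -/
theorem isLeading_pathAct_vSeq {i : ℕ → ℕ} (hi : IsPath n f i) {k : ℕ} (hk : k ≤ n)
    {ψ : (ℕ → ℕ) → K} (h : IsLeading n f ψ (cutPath i k)) :
    IsLeading n f (pathAct f hp ψ (vSeq x n i k)) i := by
  induction k generalizing ψ with
  | zero =>
    have : cutPath i 0 = i := by
      funext j
      simp [cutPath]
    simpa [vSeq, this] using h
  | succ k ih =>
    have hle := hi.two_mul_le k
    rw [vSeq]
    rcases hi.step (k := k) (by omega) with hs | hs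
    · rw [if_pos hs.symm]
      apply ih (by omega)
      convert! h using 1
      funext j
      simp only [cutPath, hs]
      have : j = k → i j = i k := by rintro rfl; rfl
      split_ifs <;> omega
    · rw [if_neg (by omega), pathAct_mul]
      apply ih (by omega)
      have hle' := hi.two_mul_le (k + 1)
      have h' : IsLeading n f ψ (midPath i k (i k) (2 * (i k + 1))) := by
        convert! h using 1
        funext j
        simp only [cutPath, midPath, hs]
        split_ifs <;> omega
      have := IsLeading.pathAct_w hp hi (by omega) hs (l := k + 1) (by omega) le_rfl h'
      rw [hs]
      convert! this using 1
      funext j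
      simp only [cutPath, midPath]
      have : j = k → i j = i k := by rintro rfl; rfl
      split_ifs <;> omega

end Triangular

/-! ### The comparison map -/

section Comparison

variable {K : Type*} [Field K] {x : K} (hp : ∀ j, p x (j + 1) ≠ 0) {n f : ℕ}

/-- The row sequence of the most dominant tableau. -/
def maxPath (n f : ℕ) : ℕ → ℕ := fun k => if k ≤ n then min (k / 2) f else 0

theorem isPath_maxPath (h : 2 * f ≤ n) : IsPath n f (maxPath n f) := by
  refine ⟨?_, ?_, ?_, ?_, ?_⟩
  · simp [maxPath]
  · intro k hk
    simp only [maxPath]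
    rw [if_pos (by omega), if_pos (by omega)]
    omega
  · intro k
    simp only [maxPath]
    split_ifs <;> omega
  · simp only [maxPath, le_refl, if_true]
    omega
  · intro k hk
    simp only [maxPath]
    rw [if_neg (by omega)]

theorem maxPath_two_mul {j : ℕ} (hj : j ≤ f) (h : 2 * f ≤ n) : maxPath n f (2 * j) = j := by
  simp only [maxPath]
  rw [if_pos (by omega)]
  omega

variable (K) in
open Classical in
/-- The indicator function of a path. -/
def pathSingle (i : ℕ → ℕ) : (ℕ → ℕ) → K := Pi.single i 1

theorem pathSingle_self (i : ℕ → ℕ) : pathSingle K i i = 1 := by simp [pathSingle]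

theorem pathSingle_of_ne {i s : ℕ → ℕ} (h : s ≠ i) : pathSingle K i s = 0 := by
  simp [pathSingle, h]

/-- The most dominant path returns to height `0` at `2j`, so its block there is one-dimensional and
`e_{2j+1}` acts by `p_2 / p_1 = x`. -/
theorem pathGen_pathSingle_maxPath (hf : 2 * f ≤ n) {j : ℕ} (hj : j < f) :
    pathGen x n f (2 * j) (pathSingle K (maxPath n f)) = x • pathSingle K (maxPath n f) := by
  have hmax := isPath_maxPath hf
  have m₀ : maxPath n f (2 * j) = j := maxPath_two_mul hj.le hf
  have m₂ : maxPath n f (2 * j + 2) = j + 1 := maxPath_two_mul (j := j + 1) hj hf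
  funext i
  rw [Pi.smul_apply, smul_eq_mul]
  by_cases hi : IsPath n f i
  swap
  · rw [pathGen_eq_zero fun h => hi h.1, pathSingle_of_ne (by rintro rfl; exact hi hmax), mul_zero]
  have hle := hi.two_mul_le (2 * j + 1)
  have hstep := hi.step (k := 2 * j) (by omega)
  by_cases hij : i (2 * j) = j
  · have hupd : Function.update i (2 * j + 1) (i (2 * j)) = i := by
      rw [Function.update_eq_self_iff]
      omega
    by_cases hc : i (2 * j + 2) = i (2 * j) + 1
    · rw [pathGen_peak hi hc (by omega), blockSum, hupd, if_neg (by omega), peakWeight, hij]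
      simp [p_one, p_two]
    · rw [pathGen_eq_zero fun h => hc h.2, pathSingle_of_ne, mul_zero]
      rintro rfl
      omega
  · have h0 : ∀ c, pathSingle K (maxPath n f) (Function.update i (2 * j + 1) c) = 0 := by
      intro c
      apply pathSingle_of_ne
      intro h
      have := congrFun h (2 * j)
      rw [Function.update_of_ne (by omega)] at this
      omega
    rw [pathGen_of_blockSum_eq_zero (by simp [blockSum, h0]), pathSingle_of_ne, mul_zero]
    rintro rfl
    exact hij m₀

theorem pathAct_oddProd_maxPath (hf : 2 * f ≤ n) {g : ℕ} (hg : g ≤ f) :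
    pathAct f hp (pathSingle K (maxPath n f)) (oddProd x n g) =
      x ^ g • pathSingle K (maxPath n f) := by
  induction g with
  | zero => simp [oddProd_zero]
  | succ g ih =>
    rw [oddProd_succ, pathAct_mul, ih (by omega), smul_pathAct, pathAct_e hp _ (by omega),
      pathGen_pathSingle_maxPath hf (by omega), smul_smul, pow_succ]

variable (lam : Ptn n)

/-- The action of the quotient algebra on functions on paths. -/
def quotRep : UpperQuot x lam →ₐ[K] (Module.End K ((ℕ → ℕ) → K))ᵐᵒᵖ :=
  (upperIdeal x lam).ringCon.liftₐ (pathRep n lam.fst hp)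
    (TwoSidedIdeal.ringCon_le_iff.mp (upperIdeal_le_ker hp lam))

/-- The comparison map from the cell module to functions on paths. -/
def cellToPath : cellModule x lam →ₗ[K] ((ℕ → ℕ) → K) where
  toFun c := (x ^ lam.fst)⁻¹ • (quotRep hp lam c.1).unop (pathSingle K (maxPath n lam.fst))
  map_add' c d := by simp
  map_smul' k c := by
    simp only [Submodule.coe_smul, map_smul, MulOpposite.unop_smul, LinearMap.smul_apply,
      RingHom.id_apply]
    rw [smul_comm]

variable {lam}

include hp in
theorem x_ne_zero : x ≠ 0 := by
  rw [← p_two x]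
  exact hp 1

/-- The factor `(x ^ f)⁻¹` in the comparison map cancels the eigenvalue of `m_λ` on the indicator of
the most dominant path. -/
theorem cellToPath_cellMk (a : TL x n) :
    cellToPath hp lam (cellMk x lam a) =
      pathAct lam.fst hp (pathSingle K (maxPath n lam.fst)) a := by
  change (x ^ lam.fst)⁻¹ • pathAct lam.fst hp (pathSingle K (maxPath n lam.fst))
    (oddProd x n lam.fst * a) = _
  rw [pathAct_mul, pathAct_oddProd_maxPath hp (f := lam.fst) lam.2 le_rfl, smul_pathAct, smul_smul,
    inv_mul_cancel₀ (pow_ne_zero _ (x_ne_zero hp)), one_smul]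

theorem exists_cellMk_eq (c : cellModule x lam) : ∃ a, cellMk x lam a = c := by
  obtain ⟨_, a, rfl⟩ := c
  exact ⟨a, rfl⟩

theorem act_cellMk (a b : TL x n) : act x (cellMk x lam a) b = cellMk x lam (a * b) := by
  apply Subtype.ext
  simp [act, cellMk, mul_assoc]

theorem cellToPath_act (c : cellModule x lam) (a : TL x n) :
    cellToPath hp lam (act x c a) = pathAct lam.fst hp (cellToPath hp lam c) a := by
  obtain ⟨b, rfl⟩ := exists_cellMk_eq c
  rw [act_cellMk, cellToPath_cellMk, cellToPath_cellMk, pathAct_mul]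

theorem isLeading_cellToPath_mTab (t : Tableau n lam) :
    IsLeading n lam.fst (cellToPath hp lam (mTab x t)) t.row := by
  rw [mTab, cellToPath_cellMk, v, vUpTo_eq_vSeq]
  apply isLeading_pathAct_vSeq hp t.isPath le_rfl
  have ht : cutPath t.row n = maxPath n lam.fst := by
    funext j
    simp only [cutPath, maxPath, t.isPath.last]
    have hj : n < j → t.row j = 0 := fun h => t.isPath.eq_zero h
    have hn : j = n → t.row j = lam.fst := by rintro rfl; exact t.isPath.last
    have hl : 2 * lam.fst ≤ n := lam.2
    split_ifs <;> omega
  rw [ht]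
  refine ⟨pathSingle_self _, fun s _ hs k => ?_⟩
  have : s = maxPath n lam.fst := by
    by_contra hne
    exact hs (pathSingle_of_ne hne)
  rw [this]

open Classical in
theorem cellToPath_f (s t : Tableau n lam) :
    cellToPath hp lam (TemperleyLieb.f x t) s.row = if s = t then 1 else 0 := by
  rw [TemperleyLieb.f, cellToPath_act, pathAct_proj, (isLeading_cellToPath_mTab hp t).1]

end Comparison

/-! ### Subalgebras generated by consecutive generators -/

section Sequences

variable {K A : Type*} [Field K] [Ring A] [Algebra K A]

theorem mem_of_mem_adjoin_of_mul_mem {s : Set A} {M : Submodule K A} (h1 : 1 ∈ M)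
    (hm : ∀ a ∈ s, ∀ b ∈ M, a * b ∈ M) {a : A} (ha : a ∈ Algebra.adjoin K s) : a ∈ M := by
  suffices h : ∀ b ∈ M, a * b ∈ M by simpa using h 1 h1
  induction ha using Algebra.adjoin_induction with
  | mem a ha => exact hm a ha
  | algebraMap r =>
    intro b hb
    rw [← Algebra.smul_def]
    exact M.smul_mem r hb
  | add a₁ a₂ _ _ h₁ h₂ =>
    intro b hb
    rw [add_mul]
    exact M.add_mem (h₁ b hb) (h₂ b hb)
  | mul a₁ a₂ _ _ h₁ h₂ =>
    intro b hb
    rw [mul_assoc]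
    exact h₁ _ (h₂ b hb)

theorem commute_of_mem_adjoin {s : Set A} {z : A} (h : ∀ a ∈ s, Commute a z) {a : A}
    (ha : a ∈ Algebra.adjoin K s) : Commute a z := by
  induction ha using Algebra.adjoin_induction with
  | mem a ha => exact h a ha
  | algebraMap r => exact Algebra.commutes r z
  | add a₁ a₂ _ _ h₁ h₂ => exact h₁.add_left h₂
  | mul a₁ a₂ _ _ h₁ h₂ => exact h₁.mul_left h₂

variable (K) in
/-- The subalgebra generated by `g 0, …, g (m - 1)`. -/
def initialAlg (g : ℕ → A) (m : ℕ) : Subalgebra K A := Algebra.adjoin K (g '' Set.Iio m)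

theorem mem_initialAlg (g : ℕ → A) {i m : ℕ} (h : i < m) : g i ∈ initialAlg K g m :=
  Algebra.subset_adjoin ⟨i, h, rfl⟩

theorem initialAlg_mono (g : ℕ → A) {m m' : ℕ} (h : m ≤ m') :
    initialAlg K g m ≤ initialAlg K g m' :=
  Algebra.adjoin_mono (Set.image_mono (Set.Iio_subset_Iio h))

/-- Sequences which satisfy relations of Temperley–Lieb type. -/
structure IsTLSeq (x : K) (g : ℕ → A) : Prop where
  sq : ∀ i, g i * g i = x • g i
  -- An arbitrary scalar, rather than `1`, accommodates indices outside the range, where `e` is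
  -- zero.
  neighbour : ∀ i, ∃ c : K, g (i + 1) * g i * g (i + 1) = c • g (i + 1)
  far : ∀ i j, i + 2 ≤ j → Commute (g i) (g j)

variable {x : K} {g : ℕ → A}

theorem IsTLSeq.commute (hg : IsTLSeq x g) {m k : ℕ} (hk : m + 1 ≤ k) {a : A}
    (ha : a ∈ initialAlg K g m) : Commute a (g k) := by
  refine commute_of_mem_adjoin ?_ ha
  rintro _ ⟨i, hi, rfl⟩
  exact hg.far i k (by have : i < m := hi; omega)

/-- With `A_m` generated by the first `m` elements, this is `A_{m+1} = A_m + A_m g_m A_m`: the right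
side contains `1` and, by the sandwich hypothesis, is stable under left multiplication by the
generators. -/
theorem mem_of_mem_initialAlg_succ {m : ℕ}
    (hs : ∀ a ∈ initialAlg K g m, ∃ c ∈ initialAlg K g (m - 1), g m * a * g m = c * g m)
    {M : Submodule K A} (h₁ : ∀ a ∈ initialAlg K g m, a ∈ M)
    (h₂ : ∀ a ∈ initialAlg K g m, ∀ b ∈ initialAlg K g m, a * g m * b ∈ M) {a : A}
    (ha : a ∈ initialAlg K g (m + 1)) : a ∈ M := by
  let D : Submodule K A := Subalgebra.toSubmodule (initialAlg K g m) ⊔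
    Submodule.span K {z | ∃ a ∈ initialAlg K g m, ∃ b ∈ initialAlg K g m, z = a * g m * b}
  have hDM : D ≤ M := by
    refine sup_le (fun a ha => h₁ a ha) (Submodule.span_le.mpr ?_)
    rintro _ ⟨a, ha, b, hb, rfl⟩
    exact h₂ a ha b hb
  apply hDM
  have hl : ∀ a ∈ initialAlg K g m, a ∈ D := fun a ha => Submodule.mem_sup_left ha
  have hr : ∀ a ∈ initialAlg K g m, ∀ b ∈ initialAlg K g m, a * g m * b ∈ D :=
    fun a ha b hb => Submodule.mem_sup_right (Submodule.subset_span ⟨a, ha, b, hb, rfl⟩)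
  refine mem_of_mem_adjoin_of_mul_mem (hl 1 (one_mem _)) ?_ ha
  rintro _ ⟨i, hi, rfl⟩
  change D ≤ D.comap (LinearMap.mulLeft K (g i))
  have hi : i < m + 1 := hi
  rcases (Nat.lt_succ_iff_lt_or_eq.mp hi) with hi | rfl
  · have hgi := mem_initialAlg (K := K) g hi
    refine sup_le (fun a ha => hl _ (mul_mem hgi ha)) (Submodule.span_le.mpr ?_)
    rintro _ ⟨a, ha, b, hb, rfl⟩
    change g i * (a * g m * b) ∈ D
    rw [← mul_assoc, ← mul_assoc]
    exact hr _ (mul_mem hgi ha) b hb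
  · refine sup_le (fun a ha => ?_) (Submodule.span_le.mpr ?_)
    · change g i * a ∈ D
      simpa using hr 1 (one_mem _) a ha
    · rintro _ ⟨a, ha, b, hb, rfl⟩
      change g i * (a * g i * b) ∈ D
      obtain ⟨c, hc, h⟩ := hs a ha
      rw [← mul_assoc, ← mul_assoc, h]
      exact hr c (initialAlg_mono g (Nat.sub_le i 1) hc) b hb

/-- Inductively, `A_{m+1} = A_m + A_m g_m A_m`, and `g_{m+1}` commutes with `A_m`; the two kinds of
terms are then settled by the square and neighbour relations. -/
theorem IsTLSeq.sandwich (hg : IsTLSeq x g) (m : ℕ) :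
    ∀ a ∈ initialAlg K g m, ∃ c ∈ initialAlg K g (m - 1), g m * a * g m = c * g m := by
  induction m with
  | zero =>
    intro a ha
    have hbot : initialAlg K g 0 = ⊥ := by simp [initialAlg]
    rw [hbot, Algebra.mem_bot] at ha
    obtain ⟨r, rfl⟩ := ha
    refine ⟨algebraMap K A (r * x), Subalgebra.algebraMap_mem _ _, ?_⟩
    rw [← Algebra.commutes, mul_assoc, hg.sq, map_mul, mul_assoc, ← Algebra.smul_def x]
  | succ m ih =>
    intro a ha
    rw [Nat.add_sub_cancel]
    let M : Submodule K A :=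
      ((Subalgebra.toSubmodule (initialAlg K g m)).map (LinearMap.mulRight K (g (m + 1)))).comap
        (LinearMap.mulRight K (g (m + 1)) ∘ₗ LinearMap.mulLeft K (g (m + 1)))
    have hM : ∀ a, a ∈ M ↔ ∃ c ∈ initialAlg K g m, g (m + 1) * a * g (m + 1) = c * g (m + 1) := by
      intro a
      simp only [M, Submodule.mem_comap, Submodule.mem_map, Subalgebra.mem_toSubmodule,
        LinearMap.mulRight_apply, LinearMap.comp_apply, LinearMap.mulLeft_apply]
      exact exists_congr fun c => and_congr_right fun _ => eq_comm
    rw [← hM]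
    refine mem_of_mem_initialAlg_succ ih (fun a ha => ?_) (fun a ha b hb => ?_) ha
    · rw [hM]
      refine ⟨x • a, Subalgebra.smul_mem _ ha x, ?_⟩
      rw [← (hg.commute le_rfl ha).eq, mul_assoc, hg.sq]
      simp
    · rw [hM]
      obtain ⟨c, hc⟩ := hg.neighbour m
      refine ⟨c • (a * b), Subalgebra.smul_mem _ (mul_mem ha hb) c, ?_⟩
      calc g (m + 1) * (a * g m * b) * g (m + 1)
          = g (m + 1) * a * g m * (b * g (m + 1)) := by simp only [mul_assoc]
        _ = a * (g (m + 1) * g m * g (m + 1)) * b := by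
          rw [(hg.commute le_rfl hb).eq, ← (hg.commute le_rfl ha).eq]
          simp only [mul_assoc]
        _ = c • (a * b) * g (m + 1) := by
          rw [hc, mul_smul_comm, smul_mul_assoc, mul_assoc, ← (hg.commute le_rfl hb).eq,
            ← mul_assoc, smul_mul_assoc]

theorem IsTLSeq.decomp (hg : IsTLSeq x g) {m : ℕ} {M : Submodule K A}
    (h₁ : ∀ a ∈ initialAlg K g m, a ∈ M)
    (h₂ : ∀ a ∈ initialAlg K g m, ∀ b ∈ initialAlg K g m, a * g m * b ∈ M) {a : A}
    (ha : a ∈ initialAlg K g (m + 1)) : a ∈ M :=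
  mem_of_mem_initialAlg_succ (hg.sandwich m) h₁ h₂ ha

theorem IsTLSeq.sandwich_succ (hg : IsTLSeq x g) (m : ℕ) :
    ∀ a ∈ initialAlg K g (m + 1), ∃ c ∈ initialAlg K g (m - 1), g m * a * g m = c * g m := by
  intro a ha
  let M : Submodule K A :=
    ((Subalgebra.toSubmodule (initialAlg K g (m - 1))).map (LinearMap.mulRight K (g m))).comap
      (LinearMap.mulRight K (g m) ∘ₗ LinearMap.mulLeft K (g m))
  have hM : ∀ a, a ∈ M ↔ ∃ c ∈ initialAlg K g (m - 1), g m * a * g m = c * g m := by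
    intro a
    simp only [M, Submodule.mem_comap, Submodule.mem_map, Subalgebra.mem_toSubmodule,
      LinearMap.mulRight_apply, LinearMap.comp_apply, LinearMap.mulLeft_apply]
    exact exists_congr fun c => and_congr_right fun _ => eq_comm
  rw [← hM]
  refine hg.decomp (fun a ha => (hM a).mpr (hg.sandwich m a ha)) (fun a ha b hb => ?_) ha
  rw [hM]
  obtain ⟨c, hc, h⟩ := hg.sandwich m a ha
  obtain ⟨d, hd, h'⟩ := hg.sandwich m b hb
  refine ⟨c * d, mul_mem hc hd, ?_⟩
  calc g m * (a * g m * b) * g m = (g m * a * g m) * (b * g m) := by simp only [mul_assoc]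
    _ = c * (g m * b * g m) := by rw [h]; simp only [mul_assoc]
    _ = c * d * g m := by rw [h', mul_assoc]

end Sequences

/-! ### Sandwiching by `m_λ` -/

section Sandwich

variable {K : Type*} [Field K] (x : K) (N : ℕ)

theorem isTLSeq_e : IsTLSeq x (e x N) where
  sq := e_mul_self x N
  neighbour i := by
    by_cases h : 1 ≤ i ∧ i < N
    · exact ⟨1, by rw [e_mul_e_mul_e x N h (Or.inr rfl), one_smul]⟩
    · exact ⟨0, by simp [e_eq_zero x N h]⟩
  far i j h := e_mul_comm x N (Or.inl h)

/-- Reading the generators downwards lets the same sandwich argument strip off low indices.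
Truncated subtraction sends every index past the end to `e_0 = 0`. -/
theorem isTLSeq_e_reverse (n : ℕ) : IsTLSeq x (fun i => e x N (n - 1 - i)) where
  sq i := e_mul_self x N _
  neighbour i := by
    by_cases h : 1 ≤ n - 1 - i ∧ n - 1 - i < N
    · exact ⟨1, by rw [e_mul_e_mul_e x N h (Or.inl (by omega)), one_smul]⟩
    · exact ⟨0, by simp [e_eq_zero x N h]⟩
  far i j h := by
    by_cases hj : n - 1 - j = 0
    · simp [hj, e_eq_zero x N (i := 0) (by omega)]
    · exact e_mul_comm x N (Or.inr (by omega))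

/-- The subalgebra generated by `e_1, …, e_{n-1}`. -/
abbrev lowAlg (n : ℕ) : Subalgebra K (TL x N) := initialAlg K (e x N) n

/-- The subalgebra generated by `e_l, …, e_{n-1}`. -/
abbrev highAlg (n l : ℕ) : Subalgebra K (TL x N) :=
  initialAlg K (fun i => e x N (n - 1 - i)) (n - l)

variable {x N}

theorem e_mem_lowAlg {i n : ℕ} (h : i < n) : e x N i ∈ lowAlg x N n := mem_initialAlg _ h

theorem lowAlg_mono {m n : ℕ} (h : m ≤ n) : lowAlg x N m ≤ lowAlg x N n := initialAlg_mono _ h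

theorem lowAlg_le_highAlg (n : ℕ) : lowAlg x N n ≤ highAlg x N n 1 := by
  refine Algebra.adjoin_le ?_
  rintro _ ⟨i, hi, rfl⟩
  have hi : i < n := hi
  by_cases h0 : i = 0
  · rw [h0, e_eq_zero x N (by omega)]
    exact zero_mem _
  · have h := mem_initialAlg (K := K) (fun i => e x N (n - 1 - i)) (i := n - 1 - i) (m := n - 1)
      (by omega)
    have h' : n - 1 - (n - 1 - i) = i := by omega
    simp only [h'] at h
    exact h

theorem lowAlg_top_eq_top : lowAlg x N N = ⊤ := by
  rw [eq_top_iff]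
  intro a _
  obtain ⟨b, rfl⟩ := RingQuot.mkAlgHom_surjective K (Rel x N) a
  induction b using FreeAlgebra.induction with
  | grade0 r =>
    rw [AlgHom.commutes]
    exact Subalgebra.algebraMap_mem _ _
  | grade1 i =>
    have h := e_of_lt x N i.2
    rw [show (⟨i.1, i.2⟩ : Gen N) = i from rfl] at h
    rw [← h]
    exact e_mem_lowAlg i.2.2
  | mul a b ha hb =>
    rw [map_mul]
    exact mul_mem (ha trivial) (hb trivial)
  | add a b ha hb =>
    rw [map_add]
    exact add_mem (ha trivial) (hb trivial)

theorem oddProd_mem (f : ℕ) : oddProd x N f ∈ lowAlg x N (2 * f) := by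
  induction f with
  | zero => exact one_mem _
  | succ f ih =>
    rw [oddProd_succ]
    exact mul_mem (lowAlg_mono (by omega) ih) (e_mem_lowAlg (by omega))

theorem commute_oddProd_e {f j : ℕ} (h : 2 * f + 1 ≤ j) : Commute (oddProd x N f) (e x N j) :=
  (isTLSeq_e x N).commute h (oddProd_mem f)

theorem oddProd_mul_self (f : ℕ) : oddProd x N f * oddProd x N f = x ^ f • oddProd x N f := by
  induction f with
  | zero => simp [oddProd_zero]
  | succ f ih =>
    rw [oddProd_succ]
    calc oddProd x N f * e x N (2 * f + 1) * (oddProd x N f * e x N (2 * f + 1))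
        = oddProd x N f * (e x N (2 * f + 1) * oddProd x N f) * e x N (2 * f + 1) := by
          simp only [mul_assoc]
      _ = (oddProd x N f * oddProd x N f) * (e x N (2 * f + 1) * e x N (2 * f + 1)) := by
          rw [← (commute_oddProd_e le_rfl).eq]
          simp only [mul_assoc]
      _ = x ^ (f + 1) • (oddProd x N f * e x N (2 * f + 1)) := by
          rw [ih, e_mul_self, smul_mul_smul_comm, pow_succ]

/-- Each further factor `e_{2f+1}` of `m` sandwiches an element generated by `e_{2f+1}, …, e_{n-1}`
and, by the reversed sequence, pushes it into the algebra generated by `e_{2f+3}, …, e_{n-1}`. -/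
theorem exists_oddProd_sandwich {n f : ℕ} (hf : 2 * f ≤ n) {a : TL x N} (ha : a ∈ lowAlg x N n) :
    ∃ c ∈ highAlg x N n (2 * f + 1), oddProd x N f * a * oddProd x N f = c * oddProd x N f := by
  induction f with
  | zero => exact ⟨a, lowAlg_le_highAlg n ha, by simp [oddProd_zero]⟩
  | succ f ih =>
    obtain ⟨c, hc, h⟩ := ih (by omega)
    have hcomm := commute_oddProd_e (x := x) (N := N) (f := f) le_rfl
    obtain ⟨d, hd, h'⟩ := (isTLSeq_e_reverse x N n).sandwich_succ (n - (2 * f + 2)) c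
      (by rwa [show n - (2 * f + 2) + 1 = n - (2 * f + 1) by omega])
    rw [show n - 1 - (n - (2 * f + 2)) = 2 * f + 1 by omega] at h'
    refine ⟨d, by rwa [highAlg, show n - (2 * (f + 1) + 1) = n - (2 * f + 2) - 1 by omega], ?_⟩
    rw [oddProd_succ]
    calc oddProd x N f * e x N (2 * f + 1) * a * (oddProd x N f * e x N (2 * f + 1))
        = e x N (2 * f + 1) * (oddProd x N f * a * oddProd x N f) * e x N (2 * f + 1) := by
          nth_rw 1 [hcomm.eq]
          simp only [mul_assoc]
      _ = (e x N (2 * f + 1) * c * e x N (2 * f + 1)) * oddProd x N f := by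
          rw [h, ← mul_assoc, mul_assoc _ (oddProd x N f), hcomm.eq, ← mul_assoc]
      _ = d * (oddProd x N f * e x N (2 * f + 1)) := by
          rw [h', mul_assoc, hcomm.eq]

variable (x N) in
/-- The two-sided ideal of the subalgebra on `n` strands generated by `e_1 e_3 ⋯ e_{2f-1}`. -/
def lowIdeal (n f : ℕ) : Submodule K (TL x N) :=
  -- When `2 * f > n` the product uses a generator outside the first `n` strands, and the ideal has
  -- to be zero.
  Submodule.span K {z | 2 * f ≤ n ∧
    ∃ a ∈ lowAlg x N n, ∃ b ∈ lowAlg x N n, z = a * oddProd x N f * b}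

theorem lowIdeal_mono {m n f : ℕ} (h : m ≤ n) : lowIdeal x N m f ≤ lowIdeal x N n f := by
  refine Submodule.span_mono ?_
  rintro _ ⟨hf, a, ha, b, hb, rfl⟩
  exact ⟨hf.trans h, a, lowAlg_mono h ha, b, lowAlg_mono h hb, rfl⟩

theorem mul_mem_lowIdeal_left {n f : ℕ} {a z : TL x N} (ha : a ∈ lowAlg x N n)
    (hz : z ∈ lowIdeal x N n f) : a * z ∈ lowIdeal x N n f := by
  revert z
  change lowIdeal x N n f ≤ (lowIdeal x N n f).comap (LinearMap.mulLeft K a)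
  refine Submodule.span_le.mpr ?_
  rintro _ ⟨hf, c, hc, b, hb, rfl⟩
  refine Submodule.subset_span ⟨hf, a * c, mul_mem ha hc, b, hb, ?_⟩
  simp [mul_assoc]

theorem mul_mem_lowIdeal_right {n f : ℕ} {a z : TL x N} (ha : a ∈ lowAlg x N n)
    (hz : z ∈ lowIdeal x N n f) : z * a ∈ lowIdeal x N n f := by
  revert z
  change lowIdeal x N n f ≤ (lowIdeal x N n f).comap (LinearMap.mulRight K a)
  refine Submodule.span_le.mpr ?_
  rintro _ ⟨hf, c, hc, b, hb, rfl⟩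
  refine Submodule.subset_span ⟨hf, c, hc, b * a, mul_mem hb ha, ?_⟩
  simp [mul_assoc]

/-- For `j = 2f + 1` the product is `m_{f+1}` itself. Higher `j` follow from `e_{j+1} e_j e_{j+1} =
e_{j+1}`, as `e_{j+1}` commutes with `m_f`. -/
theorem e_mul_oddProd_mem_lowIdeal {n f j : ℕ} (hj : 2 * f + 1 ≤ j) (hjn : j < n) (hn : n ≤ N) :
    e x N j * oddProd x N f ∈ lowIdeal x N n (f + 1) := by
  induction j, hj using Nat.le_induction with
  | base =>
    refine Submodule.subset_span ⟨by omega, 1, one_mem _, 1, one_mem _, ?_⟩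
    rw [one_mul, mul_one, oddProd_succ, (commute_oddProd_e le_rfl).eq]
  | succ j hj ih =>
    have h := ih (by omega)
    have he := e_mem_lowAlg (x := x) (N := N) hjn
    have := mul_mem_lowIdeal_right he (mul_mem_lowIdeal_left he h)
    rwa [mul_assoc, mul_assoc, (commute_oddProd_e (by omega)).eq, ← mul_assoc, ← mul_assoc,
      e_mul_e_mul_e x N ⟨by omega, by omega⟩ (Or.inr rfl)] at this

/-- The sandwich property which defines the cell form. -/
theorem exists_smul_oddProd_sub_mem {n f : ℕ} (hf : 2 * f ≤ n) (hn : n ≤ N) {a : TL x N}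
    (ha : a ∈ lowAlg x N n) :
    ∃ c : K, oddProd x N f * a * oddProd x N f - c • oddProd x N f ∈ lowIdeal x N n (f + 1) := by
  obtain ⟨b, hb, h⟩ := exists_oddProd_sandwich hf ha
  rw [h]
  -- The sandwiched element is `b m_f` with `b` generated by `e_j`, `j ≥ 2f + 1`; every nonempty
  -- word in these sends `m_f` into the higher ideal, so only the scalar part survives.
  let M : Submodule K (TL x N) :=
    (Submodule.span K {oddProd x N f} ⊔ lowIdeal x N n (f + 1)).comap
      (LinearMap.mulRight K (oddProd x N f))
  have hbM : b ∈ M := by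
    refine mem_of_mem_adjoin_of_mul_mem ?_ ?_ hb
    · rw [Submodule.mem_comap, LinearMap.mulRight_apply, one_mul]
      exact Submodule.mem_sup_left (Submodule.mem_span_singleton_self _)
    · rintro _ ⟨i, hi, rfl⟩ c hc
      have hi : i < n - (2 * f + 1) := hi
      rw [Submodule.mem_comap, LinearMap.mulRight_apply]
      dsimp only
      obtain ⟨y, hy, z, hz, hyz⟩ := Submodule.mem_sup.mp hc
      obtain ⟨k, rfl⟩ := Submodule.mem_span_singleton.mp hy
      rw [LinearMap.mulRight_apply] at hyz
      rw [mul_assoc, ← hyz, mul_add, mul_smul_comm]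
      refine Submodule.mem_sup_right (add_mem (Submodule.smul_mem _ _ ?_) ?_)
      · exact e_mul_oddProd_mem_lowIdeal (by omega) (by omega) hn
      · exact mul_mem_lowIdeal_left (e_mem_lowAlg (by omega)) hz
  obtain ⟨y, hy, z, hz, hyz⟩ := Submodule.mem_sup.mp hbM
  obtain ⟨k, rfl⟩ := Submodule.mem_span_singleton.mp hy
  rw [LinearMap.mulRight_apply] at hyz
  exact ⟨k, by rwa [← hyz, add_sub_cancel_left]⟩

end Sandwich

/-! ### The elements `m_t` span the cell module -/

section Spanning

variable {K : Type*} [Field K] {x : K} {N : ℕ}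

theorem w_mem_lowAlg {a b : ℕ} (h : a ≤ b) : w x N a b ∈ lowAlg x N b := by
  induction b, h using Nat.le_induction with
  | base =>
    rw [w_self]
    exact one_mem _
  | succ b h ih =>
    rw [w_succ x N h]
    exact mul_mem (lowAlg_mono (by omega) ih) (e_mem_lowAlg (by omega))

theorem vSeq_mem_lowAlg {i : ℕ → ℕ} (hi : ∀ k, 2 * i k ≤ k) (k : ℕ) :
    vSeq x N i k ∈ lowAlg x N k := by
  induction k with
  | zero => exact one_mem _
  | succ k ih =>
    have ih' := lowAlg_mono (Nat.le_succ k) ih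
    rw [vSeq]
    split_ifs
    · exact ih'
    · exact mul_mem (w_mem_lowAlg (hi _)) ih'

theorem IsPath.extend {n f f' : ℕ} {i : ℕ → ℕ} (hi : IsPath n f i) (hf : f' = f ∨ f' = f + 1)
    (hle : 2 * f' ≤ n + 1) : IsPath (n + 1) f' (Function.update i (n + 1) f') := by
  refine ⟨?_, ?_, ?_, ?_, ?_⟩
  · rw [Function.update_of_ne (by omega), hi.zero]
  · intro k hk
    have hl := hi.last
    by_cases h : k = n
    · subst h
      simpa [hl] using hf
    · rw [Function.update_of_ne (by omega), Function.update_of_ne (by omega)]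
      exact hi.step (by omega)
  · intro k
    by_cases h : k = n + 1
    · subst h
      simpa using hle
    · rw [Function.update_of_ne h]
      exact hi.two_mul_le k
  · simp
  · intro k hk
    rw [Function.update_of_ne (by omega)]
    exact hi.eq_zero (by omega)

theorem vSeq_extend {n f' : ℕ} (i : ℕ → ℕ) :
    vSeq x N (Function.update i (n + 1) f') (n + 1) =
      if i n = f' then vSeq x N i n else w x N (2 * f') (n + 1) * vSeq x N i n := by
  have h : vSeq x N (Function.update i (n + 1) f') n = vSeq x N i n :=
    vSeq_congr x N fun l hl => Function.update_of_ne (by omega) _ _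
  rw [vSeq, h, Function.update_self, Function.update_of_ne (by omega)]

variable (x N) in
/-- The span of the elements `m v` over all paths of length `n` ending at `f`. -/
def pathSpan (n f : ℕ) : Submodule K (TL x N) :=
  Submodule.span K {z | ∃ i, IsPath n f i ∧ z = oddProd x N f * vSeq x N i n}

theorem pathSpan_le_succ {n f : ℕ} (h : 2 * f ≤ n) : pathSpan x N n f ≤ pathSpan x N (n + 1) f := by
  refine Submodule.span_le.mpr ?_
  rintro _ ⟨i, hi, rfl⟩
  refine Submodule.subset_span ⟨_, hi.extend (Or.inl rfl) (by omega), ?_⟩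
  rw [vSeq_extend, if_pos hi.last]

theorem oddProd_succ_mul_w {n g : ℕ} :
    oddProd x N (g + 1) * w x N (2 * g + 2) (n + 1) =
      e x N (2 * g + 1) * (oddProd x N g * w x N (2 * g + 2) (n + 1)) := by
  rw [oddProd_succ, (commute_oddProd_e le_rfl).eq, mul_assoc]

theorem commute_oddProd_w {g a b : ℕ} (h : 2 * g + 1 ≤ a) (hab : a ≤ b) :
    Commute (oddProd x N g) (w x N a b) := by
  induction b, hab using Nat.le_induction with
  | base =>
    rw [w_self]
    exact Commute.one_right _
  | succ b hab ih =>
    rw [w_succ x N hab]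
    exact ih.mul_right (commute_oddProd_e (by omega))

/-- Write `m_{g+1} W = e_{2g+1} W m_g` and expand `m_g a` by induction on the number of strands.
Prolonging a path by a fall turns its term into a path term; an error term `b m_{g+1} c` is absorbed
by the sandwich property of `m_{g+1}`. -/
theorem oddProd_mul_w_mul_mem (hx : x ≠ 0) {n g : ℕ} (hn : n + 1 ≤ N) (hg : 2 * (g + 1) ≤ n + 1)
    (ih : ∀ a ∈ lowAlg x N n, oddProd x N g * a ∈ pathSpan x N n g ⊔ lowIdeal x N n (g + 1))
    {M : Submodule K (TL x N)} (hM₁ : pathSpan x N (n + 1) (g + 1) ≤ M)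
    (hM₂ : lowIdeal x N (n + 1) (g + 2) ≤ M)
    (hM : 2 * (g + 1) ≤ n → ∀ a ∈ lowAlg x N n, oddProd x N (g + 1) * a ∈ M) {a : TL x N}
    (ha : a ∈ lowAlg x N n) :
    oddProd x N (g + 1) * w x N (2 * g + 2) (n + 1) * a ∈ M := by
  set W := w x N (2 * g + 2) (n + 1) with hW
  have hWmem : W ∈ lowAlg x N (n + 1) := w_mem_lowAlg (by omega)
  have hy : oddProd x N (g + 1) * W = e x N (2 * g + 1) * W * oddProd x N g := by
    rw [hW, oddProd_succ_mul_w, (commute_oddProd_w (by omega) (by omega)).eq, mul_assoc]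
  obtain ⟨s, hs, z, hz, hsz⟩ := Submodule.mem_sup.mp (ih a ha)
  have hsM : e x N (2 * g + 1) * W * s ∈ M := by
    have : pathSpan x N n g ≤ M.comap (LinearMap.mulLeft K (e x N (2 * g + 1) * W)) := by
      refine Submodule.span_le.mpr ?_
      rintro _ ⟨i, hi, rfl⟩
      refine hM₁ (Submodule.subset_span ⟨_, hi.extend (Or.inr rfl) hg, ?_⟩)
      have hlast := hi.last
      rw [vSeq_extend, if_neg (by omega), LinearMap.mulLeft_apply, ← mul_assoc, ← hy, mul_assoc]
      rfl
    exact this hs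
  have hzM : oddProd x N (g + 1) * W * z ∈ M := by
    have : lowIdeal x N n (g + 1) ≤
        M.comap (LinearMap.mulLeft K (oddProd x N (g + 1) * W)) := by
      refine Submodule.span_le.mpr ?_
      rintro _ ⟨hle, b, hb, c, hc, rfl⟩
      obtain ⟨k, hk⟩ := exists_smul_oddProd_sub_mem hg hn
        (mul_mem hWmem (lowAlg_mono (Nat.le_succ n) hb))
      have h₁ := hM₂ (mul_mem_lowIdeal_right (lowAlg_mono (Nat.le_succ n) hc) hk)
      have h₂ := M.smul_mem k (hM hle c hc)
      have h₃ := M.add_mem h₁ h₂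
      rw [sub_mul, smul_mul_assoc, sub_add_cancel] at h₃
      change oddProd x N (g + 1) * W * (b * oddProd x N (g + 1) * c) ∈ M
      simpa only [mul_assoc] using h₃
    exact this hz
  -- The error is again a left multiple of `m_g`. Since `m_g² = x^g m_g` and `x ≠ 0`, the missing
  -- `m_g` can be reinserted in front of it.
  have hmz : oddProd x N g * z = x ^ g • z := by
    have hms : ∀ s ∈ pathSpan x N n g, oddProd x N g * s = x ^ g • s := by
      intro s hs
      induction hs using Submodule.span_induction with
      | mem s hs =>
        obtain ⟨i, -, rfl⟩ := hs
        rw [← mul_assoc, oddProd_mul_self, smul_mul_assoc]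
      | zero => simp
      | add s₁ s₂ _ _ h₁ h₂ => rw [mul_add, h₁, h₂, smul_add]
      | smul c s _ h => rw [mul_smul_comm, h, smul_comm]
    have hz' : z = oddProd x N g * a - s := by rw [← hsz, add_sub_cancel_left]
    rw [hz', mul_sub, ← mul_assoc, oddProd_mul_self, hms s hs, smul_mul_assoc, smul_sub]
  have hz₂ : e x N (2 * g + 1) * W * z = (x ^ g)⁻¹ • (oddProd x N (g + 1) * W * z) := by
    rw [hy, mul_assoc _ (oddProd x N g), hmz, mul_smul_comm, smul_smul, inv_mul_cancel₀ (pow_ne_zero _ hx), one_smul]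
  rw [hy, mul_assoc, ← hsz, mul_add, hz₂]
  exact M.add_mem hsM (M.smul_mem _ hzM)

/-- If the path ends with a rise, `e_n` commutes back to `m_f` and produces a higher ideal element.
If it ends with a fall, `e_n` commutes back to `w_{2f,n}` and lengthens it to `w_{2f,n+1}`. -/
theorem oddProd_mul_vSeq_mul_e_mem {n f : ℕ} (hn : n + 1 ≤ N) (hf : 2 * f ≤ n) {i : ℕ → ℕ}
    (hi : IsPath n f i) {c : TL x N} (hc : c ∈ lowAlg x N n) {M : Submodule K (TL x N)}
    (hM : lowIdeal x N (n + 1) (f + 1) ≤ M)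
    (hw : ∀ g, f = g + 1 → ∀ a ∈ lowAlg x N n, oddProd x N f * w x N (2 * f) (n + 1) * a ∈ M) :
    oddProd x N f * vSeq x N i n * (e x N n * c) ∈ M := by
  rcases n with _ | n
  · rw [e_eq_zero x N (by omega), zero_mul, mul_zero]
    exact zero_mem _
  have hv := vSeq_mem_lowAlg (x := x) (N := N) hi.two_mul_le n
  have hcomm := (isTLSeq_e x N).commute le_rfl hv
  have hvc := mul_mem (lowAlg_mono (Nat.le_succ n) hv) hc
  have hlast := hi.last
  rw [vSeq]
  split_ifs with hstep
  · have hle := hi.two_mul_le n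
    have hmem := mul_mem_lowIdeal_right (lowAlg_mono (Nat.le_succ _) hvc)
      (e_mul_oddProd_mem_lowIdeal (x := x) (f := f) (Nat.succ_le_succ (by omega))
        (Nat.lt_succ_self (n + 1)) hn)
    have hcomm' := commute_oddProd_e (x := x) (N := N) (f := f) (j := n + 1) (by omega)
    have heq : oddProd x N f * vSeq x N i n * (e x N (n + 1) * c) =
        e x N (n + 1) * oddProd x N f * (vSeq x N i n * c) := by
      calc _ = oddProd x N f * (vSeq x N i n * e x N (n + 1)) * c := by simp only [mul_assoc]
        _ = oddProd x N f * e x N (n + 1) * (vSeq x N i n * c) := by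
          rw [hcomm.eq]
          simp only [mul_assoc]
        _ = _ := by rw [hcomm'.eq]
    rw [heq]
    exact hM hmem
  · have hs := hi.step (k := n) (by omega)
    have hmem := hw (f - 1) (by omega) _ hvc
    rw [hlast]
    have heq : oddProd x N f * (w x N (2 * f) (n + 1) * vSeq x N i n) * (e x N (n + 1) * c) =
        oddProd x N f * w x N (2 * f) (n + 1 + 1) * (vSeq x N i n * c) := by
      calc _ = oddProd x N f * w x N (2 * f) (n + 1) * (vSeq x N i n * e x N (n + 1)) * c := by
            simp only [mul_assoc]
        _ = oddProd x N f * (w x N (2 * f) (n + 1) * e x N (n + 1)) * (vSeq x N i n * c) := by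
          rw [hcomm.eq]
          simp only [mul_assoc]
        _ = _ := by rw [w_succ x N hf]
    rw [heq]
    exact hmem

/-- The straightening rule behind the spanning statement: induction on the number of strands,
through `A_{n+1} = A_n + A_n e_n A_n`. -/
theorem oddProd_mul_mem (hx : x ≠ 0) {n : ℕ} (hn : n ≤ N) {f : ℕ} (hf : 2 * f ≤ n) {a : TL x N}
    (ha : a ∈ lowAlg x N n) :
    oddProd x N f * a ∈ pathSpan x N n f ⊔ lowIdeal x N n (f + 1) := by
  induction n generalizing f a with
  | zero =>
    obtain rfl : f = 0 := by omega
    have hbot : lowAlg x N 0 = ⊥ := by simp [initialAlg]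
    rw [hbot, Algebra.mem_bot] at ha
    obtain ⟨r, rfl⟩ := ha
    refine Submodule.mem_sup_left ?_
    rw [← Algebra.commutes, ← Algebra.smul_def]
    refine Submodule.smul_mem _ _ (Submodule.subset_span ⟨fun _ => 0, ?_, by simp [vSeq]⟩)
    exact ⟨rfl, by simp, by simp, rfl, by simp⟩
  | succ n ih =>
    have ihn : ∀ {f : ℕ}, 2 * f ≤ n → ∀ a ∈ lowAlg x N n,
        oddProd x N f * a ∈ pathSpan x N n f ⊔ lowIdeal x N n (f + 1) :=
      fun hf a ha => ih (by omega) hf ha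
    set M := pathSpan x N (n + 1) f ⊔ lowIdeal x N (n + 1) (f + 1) with hMdef
    have hlow : 2 * f ≤ n → ∀ a ∈ lowAlg x N n, oddProd x N f * a ∈ M := fun h a ha =>
      sup_le_sup (pathSpan_le_succ h) (lowIdeal_mono (Nat.le_succ n)) (ihn h a ha)
    have hw : ∀ g, f = g + 1 → ∀ a ∈ lowAlg x N n,
        oddProd x N f * w x N (2 * f) (n + 1) * a ∈ M := by
      rintro g rfl a ha
      exact oddProd_mul_w_mul_mem hx hn hf (ihn (by omega)) le_sup_left le_sup_right hlow ha
    change a ∈ M.comap (LinearMap.mulLeft K (oddProd x N f))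
    refine (isTLSeq_e x N).decomp (fun a ha => ?_) (fun b hb c hc => ?_) ha
    · rw [Submodule.mem_comap, LinearMap.mulLeft_apply]
      by_cases h : 2 * f ≤ n
      · exact hlow h a ha
      · have := hw (f - 1) (by omega) a ha
        rwa [show 2 * f = n + 1 by omega, w_self, mul_one] at this
    · rw [Submodule.mem_comap, LinearMap.mulLeft_apply]
      by_cases h : 2 * f ≤ n
      · rw [← mul_assoc, ← mul_assoc]
        have hen : e x N n ∈ lowAlg x N (n + 1) := e_mem_lowAlg (Nat.lt_succ_self n)
        have hc' := lowAlg_mono (Nat.le_succ n) hc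
        have hsub : pathSpan x N n f ⊔ lowIdeal x N n (f + 1) ≤
            M.comap (LinearMap.mulRight K (e x N n * c)) := by
          refine sup_le (Submodule.span_le.mpr ?_) fun z hz => ?_
          · rintro _ ⟨i, hi, rfl⟩
            exact oddProd_mul_vSeq_mul_e_mem hn h hi hc le_sup_right hw
          · exact Submodule.mem_sup_right (mul_mem_lowIdeal_right (mul_mem hen hc')
              (lowIdeal_mono (Nat.le_succ n) hz))
        have := hsub (ihn h b hb)
        rwa [Submodule.mem_comap, LinearMap.mulRight_apply, ← mul_assoc] at this
      -- Here `2f = n + 1`, so `e_n` is the last factor of `m_f`; sandwiching `b` between the two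
      -- copies of `e_n` reduces to the case without `e_n`.
      · obtain ⟨g, rfl⟩ : ∃ g, f = g + 1 := ⟨f - 1, by omega⟩
        obtain rfl : n = 2 * g + 1 := by omega
        obtain ⟨d, hd, hde⟩ := (isTLSeq_e x N).sandwich (2 * g + 1) b hb
        have hd' := lowAlg_mono (x := x) (N := N) (Nat.sub_le (2 * g + 1) 1) hd
        have hcomm := (isTLSeq_e x N).commute (k := 2 * g + 1) (by omega) hd
        have := hw g rfl _ (mul_mem hd' hc)
        rw [show 2 * (g + 1) = 2 * g + 1 + 1 by ring, w_self, mul_one] at this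
        rw [oddProd_succ] at this ⊢
        have heq : oddProd x N g * e x N (2 * g + 1) * (b * e x N (2 * g + 1) * c) =
            oddProd x N g * e x N (2 * g + 1) * (d * c) := by
          calc _ = oddProd x N g * (e x N (2 * g + 1) * b * e x N (2 * g + 1)) * c := by
                simp only [mul_assoc]
            _ = _ := by
              rw [hde, hcomm.eq]
              simp only [mul_assoc]
        rwa [heq]

/-! ### Passage to the cell module -/

variable {n : ℕ}

theorem lowIdeal_le_upperIdeal (lam : Ptn n) {z : TL x n} (hz : z ∈ lowIdeal x n n (lam.fst + 1)) :
    z ∈ upperIdeal x lam := by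
  induction hz using Submodule.span_induction with
  | mem z hz =>
    obtain ⟨hle, a, -, b, -, rfl⟩ := hz
    let mu : Ptn n := ⟨⟨lam.fst + 1, by omega⟩, hle⟩
    have hmu : mu.Dominates lam := Nat.lt_succ_self _
    have h : oddProd x n (lam.fst + 1) ∈ upperIdeal x lam := by
      have h₁ : mPtn x mu ∈ TwoSidedIdeal.span {mPtn x mu} :=
        TwoSidedIdeal.subset_span (Set.mem_singleton _)
      exact (le_iSup₂_of_le (f := fun (mu : Ptn n) (_ : mu.Dominates lam) =>
        TwoSidedIdeal.span {mPtn x mu}) mu hmu le_rfl) h₁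
    exact TwoSidedIdeal.mul_mem_right _ _ _ (TwoSidedIdeal.mul_mem_left _ _ _ h)
  | zero => exact TwoSidedIdeal.zero_mem _
  | add z₁ z₂ _ _ h₁ h₂ => exact TwoSidedIdeal.add_mem _ h₁ h₂
  | smul c z _ h =>
    rw [Algebra.smul_def]
    exact TwoSidedIdeal.mul_mem_left _ _ _ h

theorem toQuot_eq_zero {lam : Ptn n} {z : TL x n} (hz : z ∈ upperIdeal x lam) :
    toQuot x lam z = 0 := by
  rw [← map_zero (toQuot x lam)]
  exact (RingCon.eq _).mpr hz

theorem span_mTab (hx : x ≠ 0) (lam : Ptn n) :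
    Submodule.span K (Set.range fun t : Tableau n lam => mTab x t) = ⊤ := by
  rw [eq_top_iff]
  rintro c -
  obtain ⟨a, rfl⟩ := exists_cellMk_eq c
  have ha := oddProd_mul_mem hx le_rfl lam.2 (a := a) (by rw [lowAlg_top_eq_top]; trivial)
  have hmem : toQuot x lam (mPtn x lam * a) ∈ (Submodule.span K
      (Set.range fun t : Tableau n lam => mTab x t)).map (cellModule x lam).subtype := by
    obtain ⟨s, hs, z, hz, hsz⟩ := Submodule.mem_sup.mp ha
    change toQuot x lam (oddProd x n lam.fst * a) ∈ _
    have hz0 := toQuot_eq_zero (lowIdeal_le_upperIdeal lam hz)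
    have hsz' : oddProd x n lam.fst * a = s + z := hsz.symm
    rw [hsz', map_add, hz0, add_zero]
    have : pathSpan x n n lam.fst ≤ ((Submodule.span K
      (Set.range fun t : Tableau n lam => mTab x t)).map (cellModule x lam).subtype).comap
        (toQuot x lam).toLinearMap := by
      refine Submodule.span_le.mpr ?_
      rintro _ ⟨i, hi, rfl⟩
      obtain ⟨t, rfl⟩ := Tableau.exists_row_eq hi
      refine ⟨mTab x t, Submodule.subset_span ⟨t, rfl⟩, ?_⟩
      rw [← vUpTo_eq_vSeq]
      rfl
    exact this hs
  obtain ⟨d, hd, hda⟩ := hmem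
  have : d = cellMk x lam a := Subtype.ext hda
  rwa [← this]

end Spanning

/-! ### The form on the path representation -/

section PathForm

variable {K : Type*} [Field K] {x : K} (hp : ∀ j, p x (j + 1) ≠ 0) {n : ℕ}

variable (x) in
/-- The factor contributed to the squared norm of a path by the step from `k` to `k + 1`. -/
def stepNorm (i : ℕ → ℕ) (k : ℕ) : K :=
  if i (k + 1) = i k then 1 else p x (k - 2 * i k + 1) / p x (k - 2 * i k)

variable (x n) in
/-- The squared norm of a path. -/
def pathNorm (i : ℕ → ℕ) : K := ∏ k ∈ Finset.range n, stepNorm x i k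

-- The peak falls from height `h + 1`, the valley from height `h`, and all other falls occur at the
-- same places and heights. The quotient `p_h p_{h+2} / p_{h+1}²` is both the condition for
-- self-adjointness on a block and the ratio in the theorem.
include hp in
theorem pathNorm_peak {i : ℕ → ℕ} {j : ℕ} (hj : j + 1 < n) (hpk : i (j + 1) = i j)
    (hc : i (j + 2) = i j + 1) (hlt : 2 * i j < j) :
    pathNorm x n i =
      valleyWeight x j i * peakWeight x j i *
        pathNorm x n (Function.update i (j + 1) (i j + 1)) := by
  obtain ⟨d, rfl⟩ : ∃ d, n = j + 2 + d := ⟨n - (j + 2), by omega⟩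
  set i' := Function.update i (j + 1) (i j + 1) with hi'
  have hne : ∀ k, k ≠ j + 1 → i' k = i k := fun k hk => Function.update_of_ne hk _ _
  have hself : i' (j + 1) = i j + 1 := Function.update_self _ _ _
  have h₁ : ∏ k ∈ Finset.range j, stepNorm x i' k = ∏ k ∈ Finset.range j, stepNorm x i k := by
    refine Finset.prod_congr rfl fun k hk => ?_
    rw [Finset.mem_range] at hk
    rw [stepNorm, stepNorm, hne k (by omega), hne (k + 1) (by omega)]
  have h₂ : ∏ k ∈ Finset.range d, stepNorm x i' (j + 2 + k) =
      ∏ k ∈ Finset.range d, stepNorm x i (j + 2 + k) := by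
    refine Finset.prod_congr rfl fun k _ => ?_
    rw [stepNorm, stepNorm, hne (j + 2 + k) (by omega), hne (j + 2 + k + 1) (by omega)]
  have e₁ : stepNorm x i j = 1 := if_pos hpk
  have e₂ : stepNorm x i (j + 1) = peakWeight x j i := by
    rw [stepNorm, if_neg (by rw [hpk]; change ¬ i (j + 2) = _; omega), hpk, peakWeight,
      show j + 1 - 2 * i j = j - 2 * i j + 1 by omega]
  have e₃ : stepNorm x i' j = p x (j - 2 * i j + 1) / p x (j - 2 * i j) := by
    rw [stepNorm, hself, hne j (by omega), if_neg (by omega)]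
  have e₄ : stepNorm x i' (j + 1) = 1 := by
    rw [stepNorm, if_pos]
    rw [hself, hne (j + 1 + 1) (by omega)]
    exact hc
  obtain ⟨m, hm⟩ : ∃ m, j - 2 * i j = m + 1 := ⟨j - 2 * i j - 1, by omega⟩
  have e₅ : valleyWeight x j i * (p x (j - 2 * i j + 1) / p x (j - 2 * i j)) = 1 := by
    rw [valleyWeight, hm]
    have := hp m
    have := hp (m + 1)
    field_simp
  have hsplit : ∀ i : ℕ → ℕ, pathNorm x (j + 2 + d) i =
      (∏ k ∈ Finset.range j, stepNorm x i k) * stepNorm x i j * stepNorm x i (j + 1) *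
        ∏ k ∈ Finset.range d, stepNorm x i (j + 2 + k) := by
    intro i
    rw [pathNorm, Finset.prod_range_add _ (j + 2), Finset.prod_range_succ _ (j + 1),
      Finset.prod_range_succ _ j]
  rw [hsplit, hsplit, h₁, h₂, e₁, e₂, e₃, e₄]
  linear_combination -(∏ k ∈ Finset.range j, stepNorm x i k) * peakWeight x j i *
    (∏ k ∈ Finset.range d, stepNorm x i (j + 2 + k)) * e₅

/-- Each fall of the most dominant path starts at height `1` and contributes `p_2 / p_1 = x`; this
matches the scalar in `m_λ² = x^f m_λ`. -/
theorem pathNorm_maxPath {f : ℕ} (hf : 2 * f ≤ n) : pathNorm x n (maxPath n f) = x ^ f := by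
  have h : ∀ m ≤ n, ∏ k ∈ Finset.range m, stepNorm x (maxPath n f) k = x ^ maxPath n f m := by
    intro m hm
    induction m with
    | zero => simp [maxPath]
    | succ m ih =>
      rw [Finset.prod_range_succ, ih (by omega), stepNorm]
      rcases (isPath_maxPath hf).step (k := m) (by omega) with hs | hs
      · rw [if_pos hs, hs, mul_one]
      · have h1 : m - 2 * maxPath n f m = 1 := by
          simp only [maxPath] at hs ⊢
          rw [if_pos (by omega), if_pos (by omega)] at hs
          rw [if_pos (by omega)]
          omega
        rw [if_neg (by omega), hs, h1, p_two, p_one, div_one, pow_succ]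
  rw [pathNorm, h n le_rfl, (isPath_maxPath hf).last]

variable (x) in
/-- The diagonal form on functions on paths. -/
def pathForm (lam : Ptn n) : LinearMap.BilinForm K ((ℕ → ℕ) → K) :=
  LinearMap.mk₂ K
    (fun ψ χ => ∑ t : Tableau n lam, pathNorm x n t.row * (ψ t.row * χ t.row))
    (fun ψ₁ ψ₂ χ => by simp [add_mul, mul_add, Finset.sum_add_distrib])
    (fun c ψ χ => by
      simp only [Pi.smul_apply, smul_eq_mul, Finset.mul_sum]
      exact Finset.sum_congr rfl fun t _ => by ring)
    (fun ψ χ₁ χ₂ => by simp [mul_add, Finset.sum_add_distrib])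
    (fun c ψ χ => by
      simp only [Pi.smul_apply, smul_eq_mul, Finset.mul_sum]
      exact Finset.sum_congr rfl fun t _ => by ring)

theorem pathForm_apply (lam : Ptn n) (ψ χ : (ℕ → ℕ) → K) :
    pathForm x lam ψ χ = ∑ t : Tableau n lam, pathNorm x n t.row * (ψ t.row * χ t.row) := rfl

variable {lam : Ptn n}

-- On each block the matrix of `e_{j+1}` is symmetric for the diagonal form, thanks to the ratio of
-- peak and valley norms.
include hp in
theorem pathForm_pathGen {j : ℕ} (hj : j + 1 < n) (ψ χ : (ℕ → ℕ) → K) :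
    pathForm x lam (pathGen x n lam.fst j ψ) χ = pathForm x lam ψ (pathGen x n lam.fst j χ) := by
  classical
  -- `D` is the pointwise defect of self-adjointness. It vanishes off the two-element blocks and
  -- cancels between peak and valley, so its sum is killed by the involution `σ` exchanging them; `2
  -- * t.row j + 1 - t.row (j + 1)` is the other admissible entry.
  set D : (ℕ → ℕ) → K := fun i => pathNorm x n i *
    (pathGen x n lam.fst j ψ i * χ i - ψ i * pathGen x n lam.fst j χ i) with hD
  have hflip : ∀ t : Tableau n lam, ∃ s : Tableau n lam, D t.row ≠ 0 →
      t.row (j + 2) = t.row j + 1 ∧ 2 * t.row j < j ∧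
      s.row = Function.update t.row (j + 1) (2 * t.row j + 1 - t.row (j + 1)) := by
    intro t
    have ht := t.isPath
    by_cases h : t.row (j + 2) = t.row j + 1 ∧ 2 * t.row j < j
    · have hs := ht.step (k := j) (by omega)
      obtain ⟨s, hs⟩ := Tableau.exists_row_eq (ht.update hj h.1
        (c := 2 * t.row j + 1 - t.row (j + 1)) (by omega))
      exact ⟨s, fun _ => ⟨h.1, h.2, hs⟩⟩
    · refine ⟨t, fun hne => absurd ?_ hne⟩
      by_cases hc : t.row (j + 2) = t.row j + 1
      · have hlt : ¬ 2 * t.row j < j := fun hlt => h ⟨hc, hlt⟩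
        have hs := ht.step (k := j) (by omega)
        have hle := ht.two_mul_le (j + 1)
        have hpk : t.row (j + 1) = t.row j := by omega
        have hu : Function.update t.row (j + 1) (t.row j) = t.row := by
          rw [← hpk, Function.update_eq_self]
        simp only [hD]
        rw [pathGen_peak ht hc hpk, pathGen_peak ht hc hpk, blockSum, blockSum, hu, if_neg hlt,
          if_neg hlt]
        ring
      · simp only [hD]
        rw [pathGen_eq_zero fun h => hc h.2, pathGen_eq_zero fun h => hc h.2]
        ring
  choose σ hσ using hflip
  have hpair : ∀ i : ℕ → ℕ, IsPath n lam.fst i → i (j + 1) = i j → i (j + 2) = i j + 1 →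
      2 * i j < j → D i + D (Function.update i (j + 1) (i j + 1)) = 0 := by
    intro i hi hpk hc hlt
    have hv := hi.update hj hc (Or.inr ⟨rfl, hlt⟩)
    have hu : Function.update i (j + 1) (i j) = i := by rw [← hpk, Function.update_eq_self]
    have hw : valleyWeight x j (Function.update i (j + 1) (i j + 1)) = valleyWeight x j i := by
      simp [valleyWeight]
    simp only [hD]
    rw [pathGen_peak hi hc hpk, pathGen_peak hi hc hpk,
      pathGen_valley hv (by simpa using hc) (by simp),
      pathGen_valley hv (by simpa using hc) (by simp), blockSum_update, blockSum_update, blockSum,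
      blockSum, hu, if_pos hlt, if_pos hlt, hw, pathNorm_peak hp hj hpk hc hlt]
    ring
  have hadd : ∀ t : Tableau n lam, D t.row ≠ 0 → D t.row + D (σ t).row = 0 := by
    intro t ht
    obtain ⟨hc, hlt, hrow⟩ := hσ t ht
    rcases t.isPath.step (k := j) (by omega) with hs | hs
    · rw [show 2 * t.row j + 1 - t.row (j + 1) = t.row j + 1 by omega] at hrow
      rw [hrow]
      exact hpair t.row t.isPath hs hc hlt
    · rw [show 2 * t.row j + 1 - t.row (j + 1) = t.row j by omega] at hrow
      have h := hpair (σ t).row (σ t).isPath (by simp [hrow]) (by simp [hrow, hc])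
        (by simpa [hrow] using hlt)
      have hback : Function.update (σ t).row (j + 1) ((σ t).row j + 1) = t.row := by
        rw [hrow, Function.update_idem, Function.update_of_ne (by omega), ← hs,
          Function.update_eq_self]
      rwa [hback, add_comm] at h
  have hne : ∀ t : Tableau n lam, D t.row ≠ 0 → σ t ≠ t := by
    intro t ht heq
    obtain ⟨-, -, hrow⟩ := hσ t ht
    rw [heq] at hrow
    have h := congrFun hrow (j + 1)
    have hs := t.isPath.step (k := j) (by omega)
    rw [Function.update_self] at h
    omega
  have hσne : ∀ t : Tableau n lam, D t.row ≠ 0 → D (σ t).row ≠ 0 := by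
    intro t ht h
    have := hadd t ht
    rw [h, add_zero] at this
    exact ht this
  have hinv : ∀ t : Tableau n lam, D t.row ≠ 0 → σ (σ t) = t := by
    intro t ht
    obtain ⟨-, -, hrow⟩ := hσ t ht
    obtain ⟨-, -, hrow'⟩ := hσ (σ t) (hσne t ht)
    have hs := t.isPath.step (k := j) (by omega)
    apply Tableau.row_injective
    rw [hrow', hrow, Function.update_idem, Function.update_of_ne (by omega), Function.update_self,
      show 2 * t.row j + 1 - (2 * t.row j + 1 - t.row (j + 1)) = t.row (j + 1) by omega,
      Function.update_eq_self]
  have hsum : ∑ t : Tableau n lam, D t.row = 0 := by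
    refine Finset.sum_involution (fun t _ => if D t.row = 0 then t else σ t) (fun t _ => ?_)
      (fun t _ ht => ?_) (fun t _ => Finset.mem_univ _) (fun t _ => ?_)
    · split_ifs with h
      · rw [h, add_zero]
      · exact hadd t h
    · rw [if_neg ht]
      exact hne t ht
    · by_cases h : D t.row = 0
      · simp [h]
      · simp [h, hσne t h, hinv t h]
  rw [pathForm_apply, pathForm_apply, ← sub_eq_zero, ← Finset.sum_sub_distrib, ← hsum]
  refine Finset.sum_congr rfl fun t _ => ?_
  simp only [hD]
  ring

end PathForm

/-! ### Adjoints -/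

section Adjoint

variable {K : Type*} [Field K] {x : K} (hp : ∀ j, p x (j + 1) ≠ 0) {n : ℕ} (lam : Ptn n)

/-- The actions of `a` and `b` are adjoint with respect to the form. -/
def IsAdjointPair (a b : TL x n) : Prop :=
  ∀ ψ χ, pathForm x lam (pathAct lam.fst hp ψ a) χ = pathForm x lam ψ (pathAct lam.fst hp χ b)

variable {lam}

theorem IsAdjointPair.one : IsAdjointPair hp lam 1 1 := fun ψ χ => by simp

variable {hp}

theorem IsAdjointPair.mul {a b c d : TL x n} (h : IsAdjointPair hp lam a b)
    (h' : IsAdjointPair hp lam c d) : IsAdjointPair hp lam (a * c) (d * b) := fun ψ χ => by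
  rw [pathAct_mul, h', h, pathAct_mul]

variable (hp)

theorem isAdjointPair_e (k : ℕ) : IsAdjointPair hp lam (e x n k) (e x n k) := fun ψ χ => by
  by_cases hk : 1 ≤ k ∧ k < n
  · obtain ⟨j, rfl⟩ : ∃ j, k = j + 1 := ⟨k - 1, by omega⟩
    rw [pathAct_e hp _ hk.2, pathAct_e hp _ hk.2, pathForm_pathGen hp hk.2]
  · simp [e_eq_zero x n hk]

theorem w_succ_of_le {a b : ℕ} (h : a ≤ b) : w x n (b + 1) a = e x n b * w x n b a := by
  rw [w, if_neg (by omega), w, if_neg (by omega), show b + 1 - a = b - a + 1 by omega,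
    List.range'_concat, List.reverse_append]
  simp [show a + (b - a) = b by omega]

theorem isAdjointPair_w {a b : ℕ} (h : a ≤ b) :
    IsAdjointPair hp lam (w x n a b) (w x n b a) := by
  induction b, h using Nat.le_induction with
  | base =>
    rw [w_self]
    exact IsAdjointPair.one hp
  | succ b h ih =>
    rw [w_succ x n h, w_succ_of_le h]
    exact ih.mul (isAdjointPair_e hp b)

theorem isAdjointPair_oddProd (f : ℕ) :
    IsAdjointPair hp lam (oddProd x n f) (oddProd x n f) := by
  induction f with
  | zero => exact IsAdjointPair.one hp
  | succ f ih =>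
    have := ih.mul (isAdjointPair_e hp (2 * f + 1))
    rwa [← (commute_oddProd_e le_rfl).eq, ← oddProd_succ] at this

theorem isAdjointPair_vUpTo (t : Tableau n lam) (k : ℕ) :
    IsAdjointPair hp lam (vUpTo x t k) (vStarUpTo x t k) := by
  induction k with
  | zero => exact IsAdjointPair.one hp
  | succ k ih =>
    rw [vUpTo, vStarUpTo]
    split_ifs
    · exact ih
    · exact (isAdjointPair_w hp (t.isPath.two_mul_le _)).mul ih

/-- Reversing the word `v_t` gives `v_t^*`, and every generator is self-adjoint. This replaces an
anti-involution of the algebra. -/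
theorem isAdjointPair_v (t : Tableau n lam) : IsAdjointPair hp lam (v x t) (vStar x t) :=
  isAdjointPair_vUpTo hp t n

theorem IsAdjointPair.symm {a b : TL x n} (h : IsAdjointPair hp lam a b) :
    IsAdjointPair hp lam b a := fun ψ χ => by
  have hs : ∀ ψ χ, pathForm x lam ψ χ = pathForm x lam χ ψ := fun ψ χ => by
    rw [pathForm_apply, pathForm_apply]
    exact Finset.sum_congr rfl fun t _ => by ring
  rw [hs, ← h, hs]

end Adjoint

/-! ### The cell form -/

section CellForm

variable {K : Type*} [Field K] {x : K} (hp : ∀ j, p x (j + 1) ≠ 0) {n : ℕ} (lam : Ptn n)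

/-- The form on the cell module induced by the comparison map. -/
def inducedForm : LinearMap.BilinForm K (cellModule x lam) :=
  (pathForm x lam).compl₁₂ (cellToPath hp lam) (cellToPath hp lam)

theorem inducedForm_apply (c d : cellModule x lam) :
    inducedForm hp lam c d = pathForm x lam (cellToPath hp lam c) (cellToPath hp lam d) := rfl

theorem pathForm_maxPath :
    pathForm x lam (pathSingle K (maxPath n lam.fst)) (pathSingle K (maxPath n lam.fst)) =
      x ^ lam.fst := by
  obtain ⟨t, ht⟩ := Tableau.exists_row_eq (isPath_maxPath (f := lam.fst) lam.2)
  rw [pathForm_apply, Finset.sum_eq_single t]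
  · rw [ht, pathSingle_self, pathNorm_maxPath (f := lam.fst) lam.2, mul_one, mul_one]
  · intro s _ hs
    rw [pathSingle_of_ne fun h => hs (Tableau.row_injective (h.trans ht.symm)), mul_zero, mul_zero]
  · intro h
    exact absurd (Finset.mem_univ t) h

/-- The sandwich property supplies a scalar `c` with `m_λ v_s v_t^* m_λ ≡ c m_λ`. Applying both
sides to the indicator `δ` of the most dominant path and pairing with `δ` identifies `c`: moving
`m_λ` and `v_t^*` across the form leaves the pairing of `δ v_s` with `δ v_t`. -/
theorem isCellForm_inducedForm : IsCellForm x lam (inducedForm hp lam) := by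
  intro u s t v'
  set m := oddProd x n lam.fst with hm
  set δ := pathSingle K (maxPath n lam.fst) with hδ
  have hx := x_ne_zero hp
  have hxf : x ^ lam.fst ≠ 0 := pow_ne_zero _ hx
  have hδm : pathAct lam.fst hp δ m = x ^ lam.fst • δ :=
    pathAct_oddProd_maxPath hp (f := lam.fst) lam.2 le_rfl
  obtain ⟨c, hc⟩ := exists_smul_oddProd_sub_mem (x := x) (f := lam.fst) lam.2 (le_refl n)
    (a := v x s * vStar x t) (by rw [lowAlg_top_eq_top]; trivial)
  have hc := lowIdeal_le_upperIdeal lam hc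
  rw [← hm] at hc
  have hcB : c = inducedForm hp lam (mTab x s) (mTab x t) := by
    have h₁ := pathAct_of_mem_upperIdeal hp hc δ
    rw [pathAct_sub, pathAct_smul, pathAct_mul, pathAct_mul, hδm, smul_pathAct, smul_pathAct,
      smul_comm c, ← smul_sub, smul_eq_zero_iff_right hxf, sub_eq_zero, pathAct_mul] at h₁
    have h₂ := congrArg (fun ψ => pathForm x lam ψ δ) h₁
    rw [isAdjointPair_oddProd hp, hδm, map_smul, smul_eq_mul,
      (isAdjointPair_v hp t).symm hp, map_smul, LinearMap.smul_apply, smul_eq_mul,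
      pathForm_maxPath, mul_comm c] at h₂
    rw [inducedForm_apply, mTab, mTab, cellToPath_cellMk, cellToPath_cellMk]
    exact (mul_left_cancel₀ hxf h₂).symm
  rw [← hcB]
  have heq : mPair x u s * mPair x t v' - c • mPair x u v' =
      vStar x u * (m * (v x s * vStar x t) * m - c • m) * v x v' := by
    change vStar x u * m * v x s * (vStar x t * m * v x v') - c • (vStar x u * m * v x v') = _
    simp only [mul_sub, sub_mul, mul_assoc, mul_smul_comm, smul_mul_assoc]
  rw [heq]
  exact TwoSidedIdeal.mul_mem_right _ _ _ (TwoSidedIdeal.mul_mem_left _ _ _ hc)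

/-- For the most dominant tableau every fall into row `i` happens at `2i`, so every `w` involved is
`w_{a,a} = 1`. -/
theorem exists_mPair_eq_mPtn : ∃ t : Tableau n lam, mPair x t t = mPtn x lam := by
  have hf : 2 * lam.fst ≤ n := lam.2
  obtain ⟨t, ht⟩ := Tableau.exists_row_eq (isPath_maxPath hf)
  have hstep : ∀ k, k < n → t.row k ≠ t.row (k + 1) → 2 * t.row (k + 1) = k + 1 := by
    intro k hk hne
    rw [ht] at hne ⊢
    simp only [maxPath] at hne ⊢
    rw [if_pos (by omega), if_pos (by omega)] at hne
    rw [if_pos (by omega)]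
    omega
  have h₁ : ∀ k ≤ n, vUpTo x t k = 1 := by
    intro k hk
    induction k with
    | zero => rfl
    | succ k ih =>
      rw [vUpTo, ih (by omega)]
      split_ifs with h
      · rfl
      · rw [hstep k hk h, w_self, one_mul]
  have h₂ : ∀ k ≤ n, vStarUpTo x t k = 1 := by
    intro k hk
    induction k with
    | zero => rfl
    | succ k ih =>
      rw [vStarUpTo, ih (by omega)]
      split_ifs with h
      · rfl
      · rw [hstep k hk h, w_self, one_mul]
  refine ⟨t, ?_⟩
  rw [mPair, v, vStar, h₁ n le_rfl, h₂ n le_rfl, one_mul, mul_one]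

include hp in
theorem mPtn_notMem_upperIdeal : mPtn x lam ∉ upperIdeal x lam := by
  intro h
  have h₁ := pathAct_of_mem_upperIdeal hp h (pathSingle K (maxPath n lam.fst))
  have h₂ := pathAct_oddProd_maxPath hp (f := lam.fst) lam.2 le_rfl
  have h₃ := congrFun (h₂.symm.trans h₁) (maxPath n lam.fst)
  rw [Pi.smul_apply, pathSingle_self, smul_eq_mul, mul_one] at h₃
  exact pow_ne_zero _ (x_ne_zero hp) h₃

-- Two forms differ on `m_s`, `m_t` by a scalar whose product with `m_λ` lies in the ideal. As `m_λ`
-- is not in the ideal, the scalar is zero, and the `m_t` span.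
include hp in
theorem IsCellForm.unique {B B' : LinearMap.BilinForm K (cellModule x lam)}
    (hB : IsCellForm x lam B) (hB' : IsCellForm x lam B') : B = B' := by
  obtain ⟨u, hu⟩ := exists_mPair_eq_mPtn (x := x) lam
  have key : ∀ s t : Tableau n lam, B (mTab x s) (mTab x t) = B' (mTab x s) (mTab x t) := by
    intro s t
    by_contra hne
    have h := TwoSidedIdeal.sub_mem _ (hB' u s t u) (hB u s t u)
    rw [sub_sub_sub_cancel_left, hu] at h
    have h : (B (mTab x s) (mTab x t) - B' (mTab x s) (mTab x t)) • mPtn x lam ∈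
        upperIdeal x lam := by
      rw [Algebra.smul_def, map_sub, sub_mul, ← Algebra.smul_def, ← Algebra.smul_def]
      exact h
    apply mPtn_notMem_upperIdeal hp lam
    have h' := TwoSidedIdeal.mul_mem_left _
      (algebraMap K _ (B (mTab x s) (mTab x t) - B' (mTab x s) (mTab x t))⁻¹) _ h
    rwa [← Algebra.smul_def, smul_smul, inv_mul_cancel₀ (sub_ne_zero.mpr hne), one_smul] at h'
  refine LinearMap.ext_on_range (span_mTab (x_ne_zero hp) lam) fun s => ?_
  exact LinearMap.ext_on_range (span_mTab (x_ne_zero hp) lam) fun t => key s t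

theorem cellForm_eq_inducedForm : cellForm x lam = inducedForm hp lam :=
  IsCellForm.unique hp lam (Classical.epsilon_spec ⟨_, isCellForm_inducedForm hp lam⟩)
    (isCellForm_inducedForm hp lam)

variable {lam}

include hp in
theorem cellForm_f_self (t : Tableau n lam) : cellForm x lam (f x t) (f x t) = pathNorm x n t.row := by
  classical
  rw [cellForm_eq_inducedForm hp, inducedForm_apply, pathForm_apply]
  simp [cellToPath_f]

/-! ### The seminormal basis -/

include hp in
theorem linearIndependent_f : LinearIndependent K fun t : Tableau n lam => f x t := by
  classical
  let ev : cellModule x lam →ₗ[K] (Tableau n lam → K) :=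
    LinearMap.funLeft K K Tableau.row ∘ₗ cellToPath hp lam
  apply LinearIndependent.of_comp ev
  have : (ev ∘ fun t : Tableau n lam => f x t) = fun t => Pi.single t 1 := by
    funext t s
    simp only [ev, Function.comp_apply, LinearMap.comp_apply, LinearMap.funLeft_apply,
      cellToPath_f, Pi.single_apply]
  rw [this]
  exact Pi.linearIndependent_single_one _ _

-- The `m_t` bound the dimension by the number of tableaux, and the `f_t` are that many independent
-- vectors.
include hp in
theorem span_f : Submodule.span K (Set.range fun t : Tableau n lam => f x t) = ⊤ := by
  have hspan := span_mTab (x_ne_zero hp) lam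
  have : Module.Finite K (cellModule x lam) :=
    ⟨⟨(Set.finite_range fun t : Tableau n lam => mTab x t).toFinset, by simpa using hspan⟩⟩
  have hli := linearIndependent_f hp (lam := lam)
  apply hli.span_eq_top_of_card_eq_finrank'
  apply le_antisymm hli.fintype_card_le_finrank
  have h := finrank_range_le_card (R := K) fun t : Tableau n lam => mTab x t
  rwa [Set.finrank, hspan, finrank_top] at h

-- Evaluated at the path `s`, the expansion of `f_t e_{j+1}` shows that `e_{j+1}(s,t)` is a matrix
-- entry of `pathGen`. If it is nonzero, `s` and `t` share a block, and dominance makes `t` the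
-- valley and `s` the peak.
include hp in
theorem row_eq_update_of_eCoeff_ne_zero {j : ℕ} (hj : j + 1 < n) {s t : Tableau n lam}
    (hdom : t.Dominates s) (hne : eCoeff x (j + 1) s t ≠ 0) :
    s.row (j + 2) = s.row j + 1 ∧ s.row (j + 1) = s.row j ∧ 2 * s.row j < j ∧
      t.row = Function.update s.row (j + 1) (s.row j + 1) := by
  classical
  have hex : ∃ c : Tableau n lam → K,
      act x (f x t) (e x n (j + 1)) = ∑ u, c u • f x u := by
    have hmem : act x (f x t) (e x n (j + 1)) ∈
        Submodule.span K (Set.range fun t : Tableau n lam => f x t) := by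
      rw [span_f hp]
      trivial
    obtain ⟨c, hc⟩ := (Submodule.mem_span_range_iff_exists_fun K).mp hmem
    exact ⟨c, hc.symm⟩
  have hspec : act x (f x t) (e x n (j + 1)) = ∑ u, eCoeff x (j + 1) u t • f x u :=
    Classical.epsilon_spec hex
  have hval := congrFun (congrArg (cellToPath hp lam) hspec) s.row
  rw [cellToPath_act, pathAct_e hp _ hj, map_sum, Finset.sum_apply] at hval
  simp only [map_smul, Pi.smul_apply, cellToPath_f, smul_eq_mul, mul_ite, mul_one, mul_zero,
    Finset.sum_ite_eq, Finset.mem_univ, if_true] at hval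
  rw [← hval] at hne
  obtain ⟨hs, hc, c, hcc, hψ⟩ := exists_update_of_pathGen_ne_zero hne
  obtain ⟨u, hu⟩ := Tableau.exists_row_eq (hs.update hj hc hcc)
  rw [← hu, cellToPath_f] at hψ
  have hut : u = t := by
    by_contra h
    exact hψ (if_neg h)
  rw [hut] at hu
  have hcne : c ≠ s.row (j + 1) := by
    rintro rfl
    rw [Function.update_eq_self] at hu
    exact hdom.2 (Tableau.row_injective hu)
  have hd := hdom.1 (j + 1) (by omega) (by omega)
  rw [hu, Function.update_self] at hd
  have hstep := hs.step (k := j) (by omega)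
  have hcc' : c = s.row j + 1 := by omega
  exact ⟨hc, by omega, by omega, by rw [hu, hcc']⟩

end CellForm

end TemperleyLieb

end

open TemperleyLieb in
/-- `x` is the indeterminate of `ℤ[x]` and `F` the fraction field of `ℤ[x]`. The first two parts
say that the coefficients `e_k(s,t)` and the form `⟨·,·⟩` are well defined. -/
theorem mainTheorem8 {F : Type*} [Field F] [Algebra (Polynomial ℤ) F]
    [IsFractionRing (Polynomial ℤ) F] (x : F)
    (hx : x = algebraMap (Polynomial ℤ) F Polynomial.X) (n : ℕ) (lam : Ptn n) :
    (LinearIndependent F (fun t : Tableau n lam => f x t) ∧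
      Submodule.span F (Set.range fun t : Tableau n lam => f x t) = ⊤) ∧
    (∃! B : LinearMap.BilinForm F (cellModule x lam), IsCellForm x lam B) ∧
    ∀ k : ℕ, 1 ≤ k → k < n → ∀ s t : Tableau n lam, t.Dominates s → eCoeff x k s t ≠ 0 →
      ∀ i : ℕ, t.row k = i →
        cellForm x lam (f x s) (f x s) =
            p x (k - 2 * i + 1) * (x * p x (k - 2 * i + 2) - p x (k - 2 * i + 1)) /
              p x (k - 2 * i + 2) ^ 2 * cellForm x lam (f x t) (f x t) ∧
          cellForm x lam (f x s) (f x s) =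
            p x (k - 2 * i + 1) * p x (k - 2 * i + 3) / p x (k - 2 * i + 2) ^ 2 *
              cellForm x lam (f x t) (f x t) := by
  have hp : ∀ j, p x (j + 1) ≠ 0 := fun j => hx ▸ p_succ_ne_zero j
  refine ⟨⟨linearIndependent_f hp, span_f hp⟩,
    ⟨inducedForm hp lam, isCellForm_inducedForm hp lam,
      fun B hB => hB.unique hp lam (isCellForm_inducedForm hp lam)⟩, ?_⟩
  intro k hk hkn s t hdom hne i hi
  obtain ⟨j, rfl⟩ : ∃ j, k = j + 1 := ⟨k - 1, by omega⟩
  obtain ⟨hc, hpk, hlt, hrow⟩ := row_eq_update_of_eCoeff_ne_zero hp hkn hdom hne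
  have hi' : i = s.row j + 1 := by rw [← hi, hrow, Function.update_self]
  have hnorm := pathNorm_peak hp hkn hpk hc hlt
  rw [← hrow, valleyWeight, peakWeight] at hnorm
  -- The common height at `j` is `h + 1`; the valley `t` drops to height `h = k - 2i` at `k = j +
  -- 1`.
  obtain ⟨h, hh⟩ : ∃ h, j - 2 * s.row j = h + 1 := ⟨j - 2 * s.row j - 1, by omega⟩
  have hk' : j + 1 - 2 * i = h := by omega
  rw [cellForm_f_self hp, cellForm_f_self hp, hnorm, hh, hk', ← p_succ_succ]
  have key : p x (h + 1) / p x (h + 2) * (p x (h + 3) / p x (h + 2)) =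
      p x (h + 1) * p x (h + 3) / p x (h + 2) ^ 2 := by
    rw [div_mul_div_comm, sq]
  constructor <;> rw [← key]
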